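/- For a Lebesgue measurable set $A\subset\mathbb{R}^d$ let $P(A)=\sup\{\int_A \operatorname{div}T\,dx:\ T\in C^1_c(\mathbb{R}^d;\mathbb{R}^d),\ |T|\le 1\}$ be its De Giorgi perimeter. A measurable set $\Omega\subset\mathbb{R}^d$ is called a perimeter supersolution if $|\Omega|<\infty$, $P(\Omega)<\infty$ and $P(\Omega)\le P(\widetilde\Omega)$ for every measurable $\widetilde\Omega\supset\Omega$ with $|\widetilde\Omega|<\infty$. Let $\widetilde H^1_0(\Omega)=\{u\in H^1(\mathbb{R}^d):\ u=0 \text{ a.e. on } \Omega^c\}$, and let the torsion (energy) function $w_\Omega\in\widetilde H^1_0(\Omega)$ be the weak solution of $-\Delta w_\Omega=1$ in this space, i.e. $\int_{\mathbb{R}^d}\nabla w_\Omega\cdot\nabla v\,dx=\int_{\mathbb{R}^d} v\,dx$ for every $v\in\widetilde H^1_0(\Omega)$. **Proposition.** If the open set $\Omega\subset\mathbb{R}^d$ is a perimeter supersolution, then $w_\Omega$ is Lipschitz continuous on $\mathbb{R}^d$: it coincides almost everywhere with a Lipschitz function $W:\mathbb{R}^d\to\mathbb{R}$, and $W(x)=0$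 at every point $x$ such that $|B_r(x)\setminus\Omega|>0$ for all $r>0$. In particular, if every point of $\Omega^c$ has this property (that is, if $\Omega$ contains every point $x$ for which some ball $B_r(x)$ is contained in $\Omega$ up to a null set), then $W=0$ everywhere on $\Omega^c$. -/

import Mathlib

open MeasureTheory
open scoped ENNReal NNReal ContDiff

noncomputable section

/-- The divergence `∑ i, ∂ᵢ Tᵢ` of a vector field on `ℝ^d`. -/
def divergence {d : ℕ} (T : EuclideanSpace ℝ (Fin d) → EuclideanSpace ℝ (Fin d))
    (x : EuclideanSpace ℝ (Fin d)) : ℝ :=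
  ∑ i : Fin d, (fderiv ℝ T x (EuclideanSpace.single i 1)) i

/-- The De Giorgi perimeter `P(A) = sup {∫_A div T : T ∈ C¹_c(ℝ^d; ℝ^d), |T| ≤ 1}`. The supremum is
nonnegative because of `T = 0`, so cutting negative values off at `0` does not change it. -/
def perimeter {d : ℕ} (A : Set (EuclideanSpace ℝ (Fin d))) : ℝ≥0∞ :=
  ⨆ (T : EuclideanSpace ℝ (Fin d) → EuclideanSpace ℝ (Fin d)) (_ : ContDiff ℝ 1 T)
    (_ : HasCompactSupport T) (_ : ∀ x, ‖T x‖ ≤ 1), ENNReal.ofReal (∫ x in A, divergence T x)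

/-- A perimeter supersolution: a Lebesgue measurable set of finite measure and finite perimeter
whose perimeter is at most that of every measurable superset of finite measure. (Without finite
measure of the superset, `ℝ^d`, of perimeter `0`, would be a competitor and only null sets would
qualify.) -/
structure IsPerimeterSupersolution {d : ℕ} (Ω : Set (EuclideanSpace ℝ (Fin d))) : Prop where
  nullMeasurableSet : NullMeasurableSet Ω volume
  volume_lt_top : volume Ω < ⊤
  perimeter_lt_top : perimeter Ω < ⊤
  perimeter_le : ∀ Ω' : Set (EuclideanSpace ℝ (Fin d)), NullMeasurableSet Ω' volume → Ω ⊆ Ω' →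
    volume Ω' < ⊤ → perimeter Ω ≤ perimeter Ω'

/-- `g` is the weak (distributional) gradient of `u` on `ℝ^d`; used for `u` and `g` in `L²`. -/
def HasWeakGradient {d : ℕ} (u : EuclideanSpace ℝ (Fin d) → ℝ)
    (g : EuclideanSpace ℝ (Fin d) → EuclideanSpace ℝ (Fin d)) : Prop :=
  ∀ φ : EuclideanSpace ℝ (Fin d) → ℝ, ContDiff ℝ ∞ φ → HasCompactSupport φ → ∀ i : Fin d,
    ∫ x, u x * fderiv ℝ φ x (EuclideanSpace.single i 1) = - ∫ x, g x i * φ x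

/-- `u` belongs to `{u ∈ H¹(ℝ^d) : u = 0 a.e. on Ωᶜ}` and `g` is its weak gradient. -/
structure MemSobolevLike {d : ℕ} (Ω : Set (EuclideanSpace ℝ (Fin d)))
    (u : EuclideanSpace ℝ (Fin d) → ℝ)
    (g : EuclideanSpace ℝ (Fin d) → EuclideanSpace ℝ (Fin d)) : Prop where
  memLp : MemLp u 2 volume
  memLp_grad : MemLp g 2 volume
  hasWeakGradient : HasWeakGradient u g
  ae_eq_zero : ∀ᵐ x ∂volume, x ∉ Ω → u x = 0

/-- `w` is (a representative of) the torsion function, or energy function, of the set `Ω` of finite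
measure: the weak solution of `-Δ w = 1` in `{u ∈ H¹(ℝ^d) : u = 0 a.e. on Ωᶜ}`. -/
def IsTorsionFunction {d : ℕ} (Ω : Set (EuclideanSpace ℝ (Fin d)))
    (w : EuclideanSpace ℝ (Fin d) → ℝ) : Prop :=
  ∃ g : EuclideanSpace ℝ (Fin d) → EuclideanSpace ℝ (Fin d), MemSobolevLike Ω w g ∧
    ∀ (v : EuclideanSpace ℝ (Fin d) → ℝ)
      (h : EuclideanSpace ℝ (Fin d) → EuclideanSpace ℝ (Fin d)), MemSobolevLike Ω v h →
      ∫ x, inner ℝ (g x) (h x) = ∫ x, v x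

end

/-! Write `δ` for the distance to `Ωᶜ` and `R` for an upper bound of `δ`, which exists because `Ω`
has finite volume. The theorem follows from the fact that `δ` is superharmonic in `Ω`, and `R`
itself serves as the Lipschitz constant.

Geometry. Submodularity of the perimeter, `P(B ∪ Ω) + P(B ∩ Ω) ≤ P(B) + P(Ω)`, turns the one-sided
minimality of `Ω` into `P(B ∩ Ω) ≤ P(B)` for every measurable `B` of finite measure
(`IsPerimeterSupersolution.decreasesPerimeter`). This property survives translations and countable
intersections. Up to a null set, `{δ ≥ t}` is a countable intersection of translates of `Ω`, so it
inherits the property (`DecreasesPerimeter.setOf_le_infDist`).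

Superharmonicity. If `u ≥ δ`, then `{δ ≥ t} = {u ≥ t} ∩ {δ ≥ t}` has perimeter at most that of `{u ≥
t}`. Integrating over `t` with half of the coarea formula gives `∫ |∇δ| ≤ ∫ |∇(δ + εv)|` for
admissible `v ≥ 0`. Since `|∇δ| = 1` almost everywhere in `Ω`, the first variation of the total
variation at `δ` is that of the Dirichlet energy, and `∫ ∇δ · ∇v ≥ 0`
(`integral_inner_gradient_infDist_nonneg`).

Barrier. Formally `-Δ(Rδ - δ²/2) = -(R - δ) Δδ + |∇δ|² ≥ 1`, so comparison gives `0 ≤ w ≤ Rδ`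
(`torsion_le_barrier`).

Lipschitz bound. Off `Ω`, the barrier bound gives `w(x + a) - w(x) ≤ R|a|`. Both `w` and its
translate solve the same equation, so comparison extends the inequality to the whole space
(`torsion_translate_sub_le`), and mollification yields a Lipschitz representative.

The argument requires every point off `Ω` to see the complement in positive measure. This is
arranged by passing to the almost everywhere equal set `essInterior Ω`. -/

open Filter Set Metric
open scoped Topology Convolution

/-! ### Mollification and its convergence -/

section Mollification

variable {d : ℕ} {F : Type*} [NormedAddCommGroup F] [NormedSpace ℝ F]

local notation "E" => EuclideanSpace ℝ (Fin d)

/-- The bump function around the origin with radii `1 / (2 (n + 1))` and `1 / (n + 1)`. -/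
noncomputable def mollifierBump (d n : ℕ) : ContDiffBump (0 : EuclideanSpace ℝ (Fin d)) where
  rIn := 1 / (2 * (n + 1))
  rOut := 1 / (n + 1)
  rIn_pos := by positivity
  rIn_lt_rOut := by
    apply one_div_lt_one_div_of_lt <;> linarith [n.cast_nonneg (α := ℝ)]

/-- A smooth even probability density supported in the ball of radius `1 / (n + 1)`. -/
noncomputable def mollifier (d n : ℕ) : EuclideanSpace ℝ (Fin d) → ℝ :=
  (mollifierBump d n).normed volume

/-- The convolution of `f` with `mollifier d n`. -/
noncomputable def mollify (n : ℕ) (f : E → F) : E → F :=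
  mollifier d n ⋆[ContinuousLinearMap.lsmul ℝ ℝ, volume] f

theorem mollifier_nonneg (n : ℕ) (x : E) : 0 ≤ mollifier d n x :=
  (mollifierBump d n).nonneg_normed x

theorem mollifier_neg (n : ℕ) (x : E) : mollifier d n (-x) = mollifier d n x :=
  (mollifierBump d n).normed_neg x

theorem mollifier_sub_comm (n : ℕ) (x y : E) : mollifier d n (x - y) = mollifier d n (y - x) := by
  rw [← mollifier_neg, neg_sub]

theorem contDiff_mollifier (n : ℕ) : ContDiff ℝ ∞ (mollifier d n) :=
  (mollifierBump d n).contDiff_normed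

theorem continuous_mollifier (n : ℕ) : Continuous (mollifier d n) :=
  (contDiff_mollifier n).continuous

theorem hasCompactSupport_mollifier (n : ℕ) : HasCompactSupport (mollifier d n) :=
  (mollifierBump d n).hasCompactSupport_normed

theorem integrable_mollifier (n : ℕ) : Integrable (mollifier d n) :=
  (mollifierBump d n).integrable_normed

theorem integral_mollifier (n : ℕ) : ∫ x, mollifier d n x = 1 :=
  (mollifierBump d n).integral_normed

theorem support_mollifier_subset (n : ℕ) :
    Function.support (mollifier d n) ⊆ closedBall 0 1 := by
  rw [mollifier, ContDiffBump.support_normed_eq]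
  refine ball_subset_closedBall.trans (closedBall_subset_closedBall ?_)
  change 1 / ((n : ℝ) + 1) ≤ 1
  rw [div_le_one (by positivity)]
  linarith [n.cast_nonneg (α := ℝ)]

theorem mollify_apply (n : ℕ) (f : E → F) (x : E) :
    mollify n f x = ∫ t, mollifier d n t • f (x - t) := rfl

theorem mollify_apply_swap (n : ℕ) (f : E → F) (x : E) :
    mollify n f x = ∫ t, mollifier d n (x - t) • f t :=
  convolution_lsmul_swap

theorem integrable_mollify_integrand (n : ℕ) {f : E → F} (hf : LocallyIntegrable f) (x : E) :
    Integrable (fun t ↦ mollifier d n (x - t) • f t) := by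
  have h := ((hasCompactSupport_mollifier (d := d) n).convolutionExists_left
    (ContinuousLinearMap.lsmul ℝ ℝ) (continuous_mollifier n) hf) x
  exact h.integrable_swap

theorem integrable_mollify_integrand_left (n : ℕ) {f : E → F} (hf : LocallyIntegrable f) (x : E) :
    Integrable (fun t ↦ mollifier d n t • f (x - t)) :=
  ((hasCompactSupport_mollifier (d := d) n).convolutionExists_left
    (ContinuousLinearMap.lsmul ℝ ℝ) (continuous_mollifier n) hf) x

theorem contDiff_mollify [CompleteSpace F] (n : ℕ) {f : E → F} (hf : LocallyIntegrable f) :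
    ContDiff ℝ ∞ (mollify n f) :=
  (hasCompactSupport_mollifier n).contDiff_convolution_left _ (contDiff_mollifier n) hf

theorem ae_tendsto_mollify [CompleteSpace F] {f : E → F} (hf : LocallyIntegrable f) :
    ∀ᵐ x, Tendsto (fun n ↦ mollify n f x) atTop (𝓝 (f x)) := by
  -- `K` bounds the ratio of outer to inner radius of the bumps, here exactly 2; a bounded ratio
  -- gives convergence at Lebesgue points.
  refine ContDiffBump.ae_convolution_tendsto_right_of_locallyIntegrable (K := 2) ?_ ?_ hf
  · exact tendsto_one_div_add_atTop_nhds_zero_nat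
  · refine Eventually.of_forall fun n ↦ ?_
    change 1 / ((n : ℝ) + 1) ≤ 2 * (1 / (2 * (n + 1)))
    apply le_of_eq
    field_simp

theorem norm_mollify_le (n : ℕ) {f : E → F} {C : ℝ} (hf : ∀ x, ‖f x‖ ≤ C) (x : E) :
    ‖mollify n f x‖ ≤ C := by
  rw [mollify_apply]
  calc ‖∫ t, mollifier d n t • f (x - t)‖ ≤ ∫ t, mollifier d n t * C := by
        refine norm_integral_le_of_norm_le ((integrable_mollifier n).mul_const C)
          (Eventually.of_forall fun t ↦ ?_)
        rw [norm_smul, Real.norm_of_nonneg (mollifier_nonneg n t)]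
        exact mul_le_mul_of_nonneg_left (hf _) (mollifier_nonneg n t)
    _ = C := by rw [integral_mul_const, integral_mollifier, one_mul]

theorem integrable_mollify [CompleteSpace F] (n : ℕ) {f : E → F} (hf : Integrable f) :
    Integrable (mollify n f) :=
  (integrable_mollifier n).integrable_convolution _ hf

theorem integral_mollify (n : ℕ) {f : E → ℝ} (hf : Integrable f) :
    ∫ x, mollify n f x = ∫ x, f x := by
  have h := integral_convolution (μ := volume) (ν := volume) (ContinuousLinearMap.lsmul ℝ ℝ)
    (integrable_mollifier (d := d) n) hf
  rw [integral_mollifier] at h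
  simpa [mollify] using h

theorem mollify_sub (n : ℕ) {f g : E → F} (hf : LocallyIntegrable f) (hg : LocallyIntegrable g) :
    mollify n (fun x ↦ f x - g x) = fun x ↦ mollify n f x - mollify n g x := by
  ext x
  simp_rw [mollify_apply_swap, smul_sub]
  exact integral_sub (integrable_mollify_integrand n hf x) (integrable_mollify_integrand n hg x)

theorem mollify_congr_of_eqOn (n : ℕ) {f g : E → F} {x : E} (h : EqOn f g (closedBall x 1)) :
    mollify n f x = mollify n g x := by
  rw [mollify_apply_swap, mollify_apply_swap]
  congr 1 with t
  by_cases ht : mollifier d n (x - t) = 0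
  · simp [ht]
  · have := support_mollifier_subset n ht
    rw [h]
    rwa [mem_closedBall_zero_iff, ← dist_eq_norm, dist_comm] at this

theorem hasCompactSupport_mollify (n : ℕ) {f : E → F} (hf : HasCompactSupport f) :
    HasCompactSupport (mollify n f) :=
  (hasCompactSupport_mollifier n).convolution _ hf

theorem mollify_eq_zero_of_notMem (n : ℕ) {f : E → F} {S : Set E} (hS : Function.support f ⊆ S)
    {x : E} (hx : x ∉ cthickening 1 S) : mollify n f x = 0 := by
  have : EqOn f (fun _ ↦ (0 : F)) (closedBall x 1) := by
    intro y hy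
    by_contra h
    refine hx (mem_cthickening_of_dist_le x y 1 _ (hS h) ?_)
    rwa [mem_closedBall, dist_comm] at hy
  rw [mollify_congr_of_eqOn n this, mollify_apply]
  simp

/-- Mollification is symmetric with respect to the `L²` pairing. -/
theorem integral_mollify_mul (n : ℕ) {f g : E → ℝ} (hf : Integrable f) (hg : Integrable g) :
    ∫ x, mollify n f x * g x = ∫ x, f x * mollify n g x := by
  obtain ⟨C, hC⟩ := (hasCompactSupport_mollifier (d := d) n).exists_bound_of_continuous
    (continuous_mollifier n)
  have hint : Integrable (Function.uncurry fun x t ↦ mollifier d n (x - t) * (g x * f t))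
      ((volume : Measure E).prod (volume : Measure E)) := by
    refine (hg.mul_prod hf).bdd_mul (c := C) ?_ (Eventually.of_forall fun p ↦ hC _)
    exact ((continuous_mollifier n).comp (continuous_fst.sub continuous_snd)).aestronglyMeasurable
  have h1 : ∀ x, mollify n f x * g x = ∫ t, mollifier d n (x - t) * (g x * f t) := fun x ↦ by
    rw [mollify_apply_swap, ← integral_mul_const]
    congr 1 with t
    simp only [smul_eq_mul]; ring
  have h2 : ∀ t, f t * mollify n g t = ∫ x, mollifier d n (x - t) * (g x * f t) := fun t ↦ by
    rw [mollify_apply_swap, ← integral_const_mul]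
    congr 1 with x
    rw [mollifier_sub_comm n t x, smul_eq_mul]; ring
  simp_rw [h1, h2]
  exact integral_integral_swap hint

/-- Scheffé's argument: `f` and its mollification have the same integral, so the `L¹` distance is
twice the integral of `(f - mollify n f)⁺`, which `f` dominates. -/
theorem tendsto_integral_abs_mollify_sub_of_nonneg {f : E → ℝ} (hf : Integrable f)
    (h0 : ∀ x, 0 ≤ f x) :
    Tendsto (fun n ↦ ∫ x, |mollify n f x - f x|) atTop (𝓝 0) := by
  have hpos : ∀ n x, 0 ≤ mollify n f x := fun n x ↦ by
    rw [mollify_apply]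
    exact integral_nonneg fun t ↦ mul_nonneg (mollifier_nonneg n t) (h0 _)
  have key : ∀ n, ∫ x, |mollify n f x - f x| = 2 * ∫ x, max (f x - mollify n f x) 0 := fun n ↦ by
    have hi : Integrable fun x ↦ f x - mollify n f x := hf.sub (integrable_mollify n hf)
    have h1 : ∀ x, |mollify n f x - f x| =
        2 * max (f x - mollify n f x) 0 - (f x - mollify n f x) := fun x ↦ by
      rcases le_total (f x) (mollify n f x) with h | h
      · rw [max_eq_right (by linarith), abs_of_nonneg (by linarith)]; ring
      · rw [max_eq_left (by linarith), abs_of_nonpos (by linarith)]; ring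
    simp_rw [h1]
    have e1 : ∫ x, (f x - mollify n f x) = 0 := by
      rw [integral_sub hf (integrable_mollify n hf), integral_mollify n hf, sub_self]
    rw [integral_sub (hi.pos_part.const_mul 2) hi, integral_const_mul, e1, sub_zero]
  simp_rw [key]
  suffices h : Tendsto (fun n ↦ ∫ x, max (f x - mollify n f x) 0) atTop (𝓝 (∫ x : E, (0 : ℝ))) by
    simpa using h.const_mul 2
  refine tendsto_integral_of_dominated_convergence f (fun n ↦ ?_) hf (fun n ↦ ?_) ?_
  · exact (hf.sub (integrable_mollify n hf)).pos_part.aestronglyMeasurable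
  · refine Eventually.of_forall fun x ↦ ?_
    rw [Real.norm_of_nonneg (le_max_right _ _)]
    exact max_le (by linarith [hpos n x]) (h0 x)
  · filter_upwards [ae_tendsto_mollify hf.locallyIntegrable] with x hx
    have := (tendsto_const_nhds (x := f x)).sub hx
    simpa using this.max (tendsto_const_nhds (x := (0 : ℝ)))

theorem tendsto_integral_abs_mollify_sub {f : E → ℝ} (hf : Integrable f) :
    Tendsto (fun n ↦ ∫ x, |mollify n f x - f x|) atTop (𝓝 0) := by
  have hp := tendsto_integral_abs_mollify_sub_of_nonneg hf.pos_part fun x ↦ le_max_right _ _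
  have hn := tendsto_integral_abs_mollify_sub_of_nonneg hf.neg_part fun x ↦ le_max_right _ _
  have hs := hp.add hn
  rw [add_zero] at hs
  refine squeeze_zero (fun n ↦ integral_nonneg fun x ↦ abs_nonneg _) (fun n ↦ ?_) hs
  have i1 : Integrable fun x ↦ |mollify n (fun x ↦ max (f x) 0) x - max (f x) 0| :=
    ((integrable_mollify n hf.pos_part).sub hf.pos_part).abs
  have i2 : Integrable fun x ↦ |mollify n (fun x ↦ max (-f x) 0) x - max (-f x) 0| :=
    ((integrable_mollify n hf.neg_part).sub hf.neg_part).abs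
  rw [← integral_add i1 i2]
  refine integral_mono ((integrable_mollify n hf).sub hf).abs (i1.add i2) fun x ↦ ?_
  have e : f = fun x ↦ max (f x) 0 - max (-f x) 0 := by
    ext x
    rcases le_total 0 (f x) with h | h
    · rw [max_eq_left h, max_eq_right (by linarith)]; ring
    · rw [max_eq_right h, max_eq_left (by linarith)]; ring
  have e2 : mollify n f x = mollify n (fun x ↦ max (f x) 0) x
      - mollify n (fun x ↦ max (-f x) 0) x := by
    conv_lhs => rw [e]
    rw [mollify_sub n hf.pos_part.locallyIntegrable hf.neg_part.locallyIntegrable]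
  have e3 : f x = max (f x) 0 - max (-f x) 0 := congrFun e x
  calc |mollify n f x - f x| = |(mollify n (fun x ↦ max (f x) 0) x - max (f x) 0)
        - (mollify n (fun x ↦ max (-f x) 0) x - max (-f x) 0)| := by
        rw [e2]; congr 1; linarith
    _ ≤ _ := abs_sub _ _

/-- Mollifications of a locally integrable function converge in `L¹` on compact sets. -/
theorem tendsto_setIntegral_abs_mollify_sub {f : E → ℝ} (hf : LocallyIntegrable f) {K : Set E}
    (hK : IsCompact K) :
    Tendsto (fun n ↦ ∫ x in K, |mollify n f x - f x|) atTop (𝓝 0) := by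
  -- The mollifiers live in the unit ball, so on `K` only the values of `f` in this neighbourhood
  -- matter and `f` may be cut off outside it.
  have hK' : IsCompact (cthickening 1 K) := hK.cthickening
  have hint : Integrable (indicator (cthickening 1 K) f) :=
    (hf.integrableOn_isCompact hK').integrable_indicator hK'.measurableSet
  refine squeeze_zero (fun n ↦ integral_nonneg fun x ↦ abs_nonneg _) (fun n ↦ ?_)
    (tendsto_integral_abs_mollify_sub hint)
  have : ∫ x in K, |mollify n f x - f x| =
      ∫ x in K, |mollify n (indicator (cthickening 1 K) f) x - indicator (cthickening 1 K) f x| := by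
    refine setIntegral_congr_fun hK.measurableSet fun x hx ↦ ?_
    have hsub : closedBall x 1 ⊆ cthickening 1 K := closedBall_subset_cthickening hx 1
    have h1 : mollify n f x = mollify n (indicator (cthickening 1 K) f) x :=
      mollify_congr_of_eqOn n fun y hy ↦ (indicator_of_mem (hsub hy) f).symm
    rw [h1, indicator_of_mem (hsub (mem_closedBall_self zero_le_one))]
  rw [this]
  exact setIntegral_le_integral ((integrable_mollify n hint).sub hint).abs
    (Eventually.of_forall fun x ↦ abs_nonneg _)

/-- The derivative of the mollification is the mollification of the weak derivative. -/
theorem HasWeakGradient.fderiv_mollify {u : E → ℝ} {g : E → E} (h : HasWeakGradient u g)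
    (hu : LocallyIntegrable u) (n : ℕ) (x : E) (i : Fin d) :
    fderiv ℝ (mollify n u) x (EuclideanSpace.single i 1) = mollify n (fun y ↦ g y i) x := by
  have hc := hasCompactSupport_mollifier (d := d) n
  have h1 : ContDiff ℝ 1 (mollifier d n) := (contDiff_mollifier n).of_le (by simp)
  have hd := hc.hasFDerivAt_convolution_left (ContinuousLinearMap.lsmul ℝ ℝ) h1 hu x
  have hφ : ContDiff ℝ ∞ fun y ↦ mollifier d n (x - y) :=
    (contDiff_mollifier n).comp (contDiff_const.sub contDiff_id)
  have hφc : HasCompactSupport fun y ↦ mollifier d n (x - y) :=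
    hc.comp_homeomorph (Homeomorph.subLeft x)
  -- The kernel `y ↦ mollifier d n (x - y)` is the test function; the reflection produces a sign
  -- that cancels the one in the definition of the weak gradient.
  have key := h _ hφ hφc i
  have hder : ∀ y, fderiv ℝ (fun y ↦ mollifier d n (x - y)) y (EuclideanSpace.single i 1) =
      - fderiv ℝ (mollifier d n) (x - y) (EuclideanSpace.single i 1) := fun y ↦ by
    have := ((contDiff_mollifier (d := d) n).differentiable (by simp) (x - y)).hasFDerivAt.comp y
      ((hasFDerivAt_id y).const_sub x)
    have e : fderiv ℝ (fun y ↦ mollifier d n (x - y)) y = _ := this.fderiv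
    rw [e]
    simp
  simp_rw [hder] at key
  rw [mollify, hd.fderiv]
  have hint : ConvolutionExistsAt (fderiv ℝ (mollifier d n)) u x
      (ContinuousLinearMap.precompL E (ContinuousLinearMap.lsmul ℝ ℝ)) volume :=
    (hc.fderiv (𝕜 := ℝ)).convolutionExists_left _ (h1.continuous_fderiv (by simp)) hu x
  rw [convolution_eq_swap, ContinuousLinearMap.integral_apply hint.integrable_swap]
  rw [mollify_apply_swap]
  simp only [mul_neg, integral_neg, neg_inj] at key
  have e1 : ∫ t, mollifier d n (x - t) • g t i = ∫ t, g t i * mollifier d n (x - t) := by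
    congr 1 with t
    rw [smul_eq_mul, mul_comm]
  rw [e1, ← key]
  congr 1 with t
  simp [ContinuousLinearMap.precompL_apply, mul_comm]

end Mollification

/-! ### Weak gradients: Lipschitz functions, linearity, translation, uniqueness -/

section WeakGradient

variable {d : ℕ}

local notation "E" => EuclideanSpace ℝ (Fin d)

theorem gradient_apply (f : E → ℝ) (x : E) (i : Fin d) :
    gradient f x i = fderiv ℝ f x (EuclideanSpace.single i 1) := by
  rw [← inner_gradient_left, EuclideanSpace.inner_single_right]
  simp

theorem LipschitzWith.norm_gradient_le {C : ℝ≥0} {f : E → ℝ} (hf : LipschitzWith C f) (x : E) :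
    ‖gradient f x‖ ≤ C := by
  rw [gradient, LinearIsometryEquiv.norm_map]
  exact norm_fderiv_le_of_lipschitz ℝ hf

theorem measurable_gradient (f : E → ℝ) : Measurable (gradient f) :=
  (InnerProductSpace.toDual ℝ E).symm.continuous.measurable.comp (measurable_fderiv ℝ f)

theorem LipschitzWith.locallyIntegrable_gradient {C : ℝ≥0} {f : E → ℝ} (hf : LipschitzWith C f) :
    LocallyIntegrable (gradient f) :=
  (memLp_top_of_bound (measurable_gradient f).aestronglyMeasurable C
    (Eventually.of_forall hf.norm_gradient_le)).locallyIntegrable le_top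

theorem locallyIntegrable_coord {g : E → E} (hg : LocallyIntegrable g) (i : Fin d) :
    LocallyIntegrable fun x ↦ g x i := fun x ↦ by
  obtain ⟨s, hs, hi⟩ := hg x
  exact ⟨s, hs, (EuclideanSpace.proj i : E →L[ℝ] ℝ).integrable_comp hi⟩

theorem MeasureTheory.LocallyIntegrable.integrable_mul_of_hasCompactSupport {u ψ : E → ℝ}
    (hu : LocallyIntegrable u) (hψ : Continuous ψ) (hc : HasCompactSupport ψ) :
    Integrable fun x ↦ u x * ψ x :=
  hu.integrable_smul_right_of_hasCompactSupport hψ hc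

theorem continuous_fderiv_apply_const {φ : E → ℝ} (hφ : ContDiff ℝ 1 φ) (v : E) :
    Continuous fun x ↦ fderiv ℝ φ x v :=
  (hφ.continuous_fderiv (by simp)).clm_apply continuous_const

theorem integrable_mul_fderiv {u φ : E → ℝ} (hu : LocallyIntegrable u) (hφ : ContDiff ℝ ∞ φ)
    (hc : HasCompactSupport φ) (v : E) : Integrable fun x ↦ u x * fderiv ℝ φ x v :=
  hu.integrable_mul_of_hasCompactSupport (continuous_fderiv_apply_const (hφ.of_le (by simp)) v)
    (hc.fderiv_apply (𝕜 := ℝ) v)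

theorem integrable_coord_mul {g : E → E} {φ : E → ℝ} (hg : LocallyIntegrable g)
    (hφ : ContDiff ℝ ∞ φ) (hc : HasCompactSupport φ) (i : Fin d) :
    Integrable fun x ↦ g x i * φ x :=
  (locallyIntegrable_coord hg i).integrable_mul_of_hasCompactSupport hφ.continuous hc

/-- By Rademacher's theorem the line derivatives, which can be integrated by parts, are almost
everywhere the components of the classical gradient. -/
theorem LipschitzWith.hasWeakGradient {C : ℝ≥0} {f : E → ℝ} (hf : LipschitzWith C f) :
    HasWeakGradient f (gradient f) := by
  intro φ hφ hc i
  obtain ⟨D, hD⟩ := ContDiff.lipschitzWith_of_hasCompactSupport hc hφ (by simp)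
  have h := hf.integral_lineDeriv_mul_eq (μ := volume) hD hc (EuclideanSpace.single i 1)
  have e1 : ∫ x, gradient f x i * φ x = ∫ x, lineDeriv ℝ f x (EuclideanSpace.single i 1) * φ x := by
    refine integral_congr_ae ?_
    filter_upwards [hf.ae_differentiableAt (μ := volume)] with x hx
    rw [hx.lineDeriv_eq_fderiv, gradient_apply]
  have e2 : ∀ x, lineDeriv ℝ φ x (-EuclideanSpace.single i 1) * f x =
      -(f x * fderiv ℝ φ x (EuclideanSpace.single i 1)) := fun x ↦ by
    rw [((hφ.differentiable (by simp)) x).lineDeriv_eq_fderiv]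
    simp [mul_comm]
  rw [e1, h]
  simp_rw [e2]
  rw [integral_neg, neg_neg]

/-- Weak gradients may be tested with compactly supported Lipschitz functions. -/
theorem HasWeakGradient.integral_mul_gradient {u : E → ℝ} {g : E → E} (h : HasWeakGradient u g)
    (hu : LocallyIntegrable u) (hg : LocallyIntegrable g) {C : ℝ≥0} {φ : E → ℝ}
    (hφ : LipschitzWith C φ) (hc : HasCompactSupport φ) (i : Fin d) :
    ∫ x, u x * gradient φ x i = - ∫ x, g x i * φ x := by
  -- One compact set carries all mollifications of `φ` and of its derivatives, which gives a common
  -- dominating function for both limits.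
  set K := cthickening 1 (tsupport φ)
  have hK : IsCompact K := hc.isCompact.cthickening
  have hgi := locallyIntegrable_coord hg i
  have hder : ∀ n x, fderiv ℝ (mollify n φ) x (EuclideanSpace.single i 1) =
      mollify n (fun y ↦ gradient φ y i) x := fun n x ↦
    hφ.hasWeakGradient.fderiv_mollify hφ.continuous.locallyIntegrable n x i
  obtain ⟨M, hM⟩ := hc.exists_bound_of_continuous hφ.continuous
  have hsupp : Function.support (fun y ↦ gradient φ y i) ⊆ tsupport φ := by
    intro y hy
    by_contra hn
    apply hy
    simp only [gradient_apply]
    have : fderiv ℝ φ y = 0 := by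
      by_contra h0
      exact hn (support_fderiv_subset ℝ h0)
    simp [this]
  have hbound : ∀ y, ‖gradient φ y i‖ ≤ C := fun y ↦
    (PiLp.norm_apply_le _ i).trans (hφ.norm_gradient_le y)
  have dom : ∀ {v : E → ℝ} (_ : LocallyIntegrable v) {a : ℕ → E → ℝ} {b : E → ℝ} {M : ℝ},
      (∀ n, Continuous (a n)) → (∀ n x, ‖a n x‖ ≤ M) → (∀ n, ∀ x ∉ K, a n x = 0) →
      (∀ᵐ x, Tendsto (fun n ↦ a n x) atTop (𝓝 (b x))) →
      Tendsto (fun n ↦ ∫ x, v x * a n x) atTop (𝓝 (∫ x, v x * b x)) := by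
    intro v hv a b M ha hM h0 hlim
    refine tendsto_integral_of_dominated_convergence (fun x ↦ K.indicator (fun x ↦ ‖v x‖ * M) x)
      (fun n ↦ hv.aestronglyMeasurable.mul (ha n).aestronglyMeasurable) ?_ (fun n ↦ ?_) ?_
    · exact IntegrableOn.integrable_indicator ((hv.integrableOn_isCompact hK).norm.mul_const M)
        hK.measurableSet
    · refine Eventually.of_forall fun x ↦ ?_
      by_cases hx : x ∈ K
      · rw [indicator_of_mem hx, norm_mul]
        exact mul_le_mul_of_nonneg_left (hM n x) (norm_nonneg _)
      · simp [h0 n x hx, indicator_of_notMem hx]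
    · filter_upwards [hlim] with x hx using hx.const_mul _
  have t1 := dom hu (b := fun x ↦ gradient φ x i) (M := C)
    (fun n ↦ (contDiff_mollify n (locallyIntegrable_coord hφ.locallyIntegrable_gradient i)).continuous)
    (fun n ↦ norm_mollify_le n hbound) (fun n x hx ↦ mollify_eq_zero_of_notMem n hsupp hx)
    (ae_tendsto_mollify (locallyIntegrable_coord hφ.locallyIntegrable_gradient i))
  have t2 := dom hgi (b := φ)
    (fun n ↦ (contDiff_mollify n hφ.continuous.locallyIntegrable).continuous)
    (fun n ↦ norm_mollify_le n hM)
    (fun n x hx ↦ mollify_eq_zero_of_notMem n (subset_tsupport φ) hx)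
    (ae_tendsto_mollify hφ.continuous.locallyIntegrable)
  refine tendsto_nhds_unique t1 (t2.neg.congr fun n ↦ ?_)
  simp_rw [← hder]
  exact (h _ (contDiff_mollify n hφ.continuous.locallyIntegrable)
    (hasCompactSupport_mollify n hc) i).symm

theorem HasWeakGradient.integral_mul_fderiv {u : E → ℝ} {g : E → E} (h : HasWeakGradient u g)
    (hu : LocallyIntegrable u) (hg : LocallyIntegrable g) {φ : E → ℝ}
    (hφ : ContDiff ℝ 1 φ) (hc : HasCompactSupport φ) (i : Fin d) :
    ∫ x, u x * fderiv ℝ φ x (EuclideanSpace.single i 1) = - ∫ x, g x i * φ x := by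
  obtain ⟨D, hD⟩ := ContDiff.lipschitzWith_of_hasCompactSupport hc hφ (by simp)
  simp_rw [← h.integral_mul_gradient hu hg hD hc i, gradient_apply]

theorem HasWeakGradient.congr {u u' : E → ℝ} {g g' : E → E} (h : HasWeakGradient u g)
    (hu : u =ᵐ[volume] u') (hg : g =ᵐ[volume] g') : HasWeakGradient u' g' := by
  intro φ hφ hc i
  have e1 : ∫ x, u' x * fderiv ℝ φ x (EuclideanSpace.single i 1) =
      ∫ x, u x * fderiv ℝ φ x (EuclideanSpace.single i 1) :=
    integral_congr_ae (by filter_upwards [hu] with x hx; rw [hx])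
  have e2 : ∫ x, g' x i * φ x = ∫ x, g x i * φ x :=
    integral_congr_ae (by filter_upwards [hg] with x hx; rw [hx])
  rw [e1, e2, h φ hφ hc i]

theorem HasWeakGradient.add {u v : E → ℝ} {g h : E → E} (hug : HasWeakGradient u g)
    (hvh : HasWeakGradient v h) (hu : LocallyIntegrable u) (hv : LocallyIntegrable v)
    (hg : LocallyIntegrable g) (hh : LocallyIntegrable h) :
    HasWeakGradient (fun x ↦ u x + v x) (fun x ↦ g x + h x) := by
  intro φ hφ hc i
  simp only [add_mul, PiLp.add_apply]
  rw [integral_add (integrable_mul_fderiv hu hφ hc _) (integrable_mul_fderiv hv hφ hc _),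
    integral_add (integrable_coord_mul hg hφ hc i) (integrable_coord_mul hh hφ hc i),
    hug φ hφ hc i, hvh φ hφ hc i, neg_add]

theorem HasWeakGradient.const_mul {u : E → ℝ} {g : E → E} (hug : HasWeakGradient u g) (c : ℝ) :
    HasWeakGradient (fun x ↦ c * u x) (fun x ↦ c • g x) := by
  intro φ hφ hc i
  simp only [PiLp.smul_apply, smul_eq_mul, mul_assoc]
  rw [integral_const_mul, integral_const_mul, hug φ hφ hc i, mul_neg]

theorem HasWeakGradient.neg {u : E → ℝ} {g : E → E} (hug : HasWeakGradient u g) :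
    HasWeakGradient (fun x ↦ -u x) (fun x ↦ -g x) := by
  simpa using hug.const_mul (-1)

theorem HasWeakGradient.sub {u v : E → ℝ} {g h : E → E} (hug : HasWeakGradient u g)
    (hvh : HasWeakGradient v h) (hu : LocallyIntegrable u) (hv : LocallyIntegrable v)
    (hg : LocallyIntegrable g) (hh : LocallyIntegrable h) :
    HasWeakGradient (fun x ↦ u x - v x) (fun x ↦ g x - h x) := by
  simpa only [sub_eq_add_neg] using hug.add hvh.neg hu hv.neg hg hh.neg

theorem hasWeakGradient_const (c : ℝ) :
    HasWeakGradient (fun _ : E ↦ c) (fun _ ↦ 0) := by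
  have := (LipschitzWith.const (α := E) c).hasWeakGradient
  refine this.congr (EventuallyEq.refl _ _) (Eventually.of_forall fun x ↦ ?_)
  simp [gradient]

theorem HasWeakGradient.add_const {u : E → ℝ} {g : E → E} (hug : HasWeakGradient u g)
    (hu : LocallyIntegrable u) (hg : LocallyIntegrable g) (c : ℝ) :
    HasWeakGradient (fun x ↦ u x + c) g := by
  simpa using hug.add (hasWeakGradient_const c) hu (locallyIntegrable_const c) hg
    (locallyIntegrable_const 0)

theorem HasWeakGradient.comp_add {u : E → ℝ} {g : E → E} (hug : HasWeakGradient u g) (a : E) :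
    HasWeakGradient (fun x ↦ u (x + a)) (fun x ↦ g (x + a)) := by
  intro φ hφ hc i
  have hφ' : ContDiff ℝ ∞ fun y ↦ φ (y - a) := hφ.comp (contDiff_id.sub contDiff_const)
  have hc' : HasCompactSupport fun y ↦ φ (y - a) := hc.comp_homeomorph (Homeomorph.subRight a)
  have key := hug _ hφ' hc' i
  simp_rw [fderiv_comp_sub] at key
  rw [← integral_add_right_eq_self _ a, ← integral_add_right_eq_self (fun x ↦ g x i * φ (x - a)) a]
    at key
  simpa using key

/-- The weak gradient is unique. -/
theorem HasWeakGradient.ae_eq {u : E → ℝ} {g h : E → E} (hg : HasWeakGradient u g)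
    (hh : HasWeakGradient u h) (hgi : LocallyIntegrable g) (hhi : LocallyIntegrable h) :
    g =ᵐ[volume] h := by
  have key : ∀ i, ∀ᵐ x, g x i = h x i := fun i ↦ by
    refine ae_eq_of_integral_contDiff_smul_eq (locallyIntegrable_coord hgi i)
      (locallyIntegrable_coord hhi i) fun φ hφ hc ↦ ?_
    have := (hg φ hφ hc i).symm.trans (hh φ hφ hc i)
    simpa [mul_comm] using this
  filter_upwards [ae_all_iff.2 key] with x hx
  ext i
  exact hx i

end WeakGradient

/-! ### Chain rule, positive part and product rule -/

section ChainRule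

variable {d : ℕ}

local notation "E" => EuclideanSpace ℝ (Fin d)

theorem tendsto_integral_mul_zero_of_setIntegral {K : Set E} (hK : IsCompact K) {a : ℕ → E → ℝ}
    (ha : ∀ n, LocallyIntegrable (a n))
    (hlim : Tendsto (fun n ↦ ∫ x in K, |a n x|) atTop (𝓝 0)) {ψ : ℕ → E → ℝ} {M : ℝ}
    (hM : ∀ n x, |ψ n x| ≤ M) (h0 : ∀ n, ∀ x ∉ K, ψ n x = 0) :
    Tendsto (fun n ↦ ∫ x, a n x * ψ n x) atTop (𝓝 0) := by
  have hl := hlim.mul_const M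
  rw [zero_mul] at hl
  refine squeeze_zero_norm (fun n ↦ ?_) hl
  rw [← setIntegral_eq_integral_of_forall_compl_eq_zero (s := K)
    (fun x hx ↦ by rw [h0 n x hx, mul_zero]), ← integral_mul_const]
  refine norm_integral_le_of_norm_le
    (((ha n).integrableOn_isCompact hK).norm.mul_const M) (Eventually.of_forall fun x ↦ ?_)
  rw [norm_mul]
  exact mul_le_mul_of_nonneg_left (hM n x) (norm_nonneg _)

/-- Chain rule for `C¹` functions with bounded derivative. -/
theorem HasWeakGradient.comp_of_hasDerivAt {u : E → ℝ} {g : E → E} (h : HasWeakGradient u g)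
    (hu : LocallyIntegrable u) (hg : LocallyIntegrable g) {Φ Φ' : ℝ → ℝ}
    (hΦ : ∀ s, HasDerivAt Φ (Φ' s) s) (hΦ' : Continuous Φ') (hb : ∀ s, |Φ' s| ≤ 1) :
    HasWeakGradient (fun x ↦ Φ (u x)) (fun x ↦ Φ' (u x) • g x) := by
  intro φ hφ hc i
  have hgi := locallyIntegrable_coord hg i
  have hlip : ∀ s t, |Φ s - Φ t| ≤ |s - t| := fun s t ↦ by
    have := convex_univ.norm_image_sub_le_of_norm_hasDerivWithin_le (C := 1)
      (fun x _ ↦ (hΦ x).hasDerivWithinAt) (fun x _ ↦ hb x) (mem_univ t) (mem_univ s)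
    simpa using this
  have hΦc : Continuous Φ := continuous_iff_continuousAt.2 fun s ↦ (hΦ s).continuousAt
  have hcomp : ∀ {v : E → ℝ}, LocallyIntegrable v → LocallyIntegrable fun x ↦ Φ (v x) := by
    intro v hv
    have hvn : LocallyIntegrable fun x ↦ ‖v x‖ :=
      hv.mono hv.aestronglyMeasurable.norm (Eventually.of_forall fun x ↦ by simp)
    refine (hvn.add (locallyIntegrable_const |Φ 0|)).mono
      (hΦc.comp_aestronglyMeasurable hv.aestronglyMeasurable) (Eventually.of_forall fun x ↦ ?_)
    have h1 := hlip (v x) 0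
    have h2 := abs_sub_abs_le_abs_sub (Φ (v x)) (Φ 0)
    simp only [Real.norm_eq_abs, Pi.add_apply]
    rw [sub_zero] at h1
    exact (by linarith : |Φ (v x)| ≤ |v x| + |Φ 0|).trans (le_abs_self _)
  set K := tsupport φ
  have hK : IsCompact K := hc.isCompact
  set e : E := EuclideanSpace.single i 1
  have hψ : Continuous fun x ↦ fderiv ℝ φ x e := continuous_fderiv_apply_const (hφ.of_le (by simp)) e
  have hψc : HasCompactSupport fun x ↦ fderiv ℝ φ x e := hc.fderiv_apply (𝕜 := ℝ) e
  obtain ⟨M₁, hM₁⟩ := hψc.exists_bound_of_continuous hψ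
  obtain ⟨M₂, hM₂⟩ := hc.exists_bound_of_continuous hφ.continuous
  have hψ0 : ∀ x ∉ K, fderiv ℝ φ x e = 0 := fun x hx ↦ by
    have : fderiv ℝ φ x = 0 := by
      by_contra h0
      exact hx (support_fderiv_subset ℝ h0)
    simp [this]
  have hφ0 : ∀ x ∉ K, φ x = 0 := fun x hx ↦ image_eq_zero_of_notMem_tsupport hx
  have hU : ∀ n, ContDiff ℝ ∞ (mollify n u) := fun n ↦ contDiff_mollify n hu
  have hG : ∀ n, Continuous (mollify n fun y ↦ g y i) := fun n ↦ (contDiff_mollify n hgi).continuous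
  have hΦU : ∀ n x, HasFDerivAt (fun x ↦ Φ (mollify n u x))
      (Φ' (mollify n u x) • fderiv ℝ (mollify n u) x) x := fun n x ↦
    (hΦ _).comp_hasFDerivAt x ((hU n).differentiable (by simp) x).hasFDerivAt
  have hfd : ∀ n x, fderiv ℝ (fun x ↦ Φ (mollify n u x)) x e =
      Φ' (mollify n u x) * mollify n (fun y ↦ g y i) x := fun n x ↦ by
    rw [(hΦU n x).fderiv, smul_apply, h.fderiv_mollify hu n x i, smul_eq_mul]
  have parts : ∀ n, ∫ x, Φ (mollify n u x) * fderiv ℝ φ x e =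
      - ∫ x, Φ' (mollify n u x) * mollify n (fun y ↦ g y i) x * φ x := fun n ↦ by
    simp_rw [← hfd]
    have c1 : Continuous fun x ↦ Φ (mollify n u x) := hΦc.comp (hU n).continuous
    have c2 : Continuous fun x ↦ fderiv ℝ (fun x ↦ Φ (mollify n u x)) x e := by
      simp_rw [hfd]
      exact (hΦ'.comp (hU n).continuous).mul (hG n)
    refine integral_mul_fderiv_eq_neg_fderiv_mul_of_integrable ?_ ?_ ?_ ?_ ?_
    · exact c2.locallyIntegrable.integrable_mul_of_hasCompactSupport hφ.continuous hc
    · exact c1.locallyIntegrable.integrable_mul_of_hasCompactSupport hψ hψc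
    · exact c1.locallyIntegrable.integrable_mul_of_hasCompactSupport hφ.continuous hc
    · exact fun x _ ↦ (hΦU n x).differentiableAt
    · exact fun x _ ↦ hφ.differentiable (by simp) x
  have hUi : ∀ n, LocallyIntegrable (mollify n u) := fun n ↦ (hU n).continuous.locallyIntegrable
  have t1 : Tendsto (fun n ↦ ∫ x, Φ (mollify n u x) * fderiv ℝ φ x e) atTop
      (𝓝 (∫ x, Φ (u x) * fderiv ℝ φ x e)) := by
    have hz : Tendsto (fun n ↦ ∫ x, (Φ (mollify n u x) - Φ (u x)) * fderiv ℝ φ x e) atTop (𝓝 0) := by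
      refine tendsto_integral_mul_zero_of_setIntegral hK (fun n ↦ (hcomp (hUi n)).sub (hcomp hu))
        ?_ (fun _ ↦ hM₁) (fun _ ↦ hψ0)
      refine squeeze_zero (fun n ↦ integral_nonneg fun x ↦ abs_nonneg _) (fun n ↦ ?_)
        (tendsto_setIntegral_abs_mollify_sub hu hK)
      exact integral_mono
        (((hcomp (hUi n)).sub (hcomp hu)).integrableOn_isCompact hK).norm
        (((hUi n).sub hu).integrableOn_isCompact hK).norm fun x ↦ hlip _ _
    refine tendsto_sub_nhds_zero_iff.1 (hz.congr fun n ↦ ?_)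
    simp_rw [sub_mul]
    exact integral_sub ((hcomp (hUi n)).integrable_mul_of_hasCompactSupport hψ hψc)
      ((hcomp hu).integrable_mul_of_hasCompactSupport hψ hψc)
  have hgφ := hgi.integrable_mul_of_hasCompactSupport hφ.continuous hc
  have hbdd : ∀ {v : E → ℝ}, AEStronglyMeasurable v volume →
      Integrable fun x ↦ g x i * φ x * Φ' (v x) := fun {v} hv ↦
    hgφ.mul_bdd (c := 1) (hΦ'.comp_aestronglyMeasurable hv) (Eventually.of_forall fun x ↦ hb _)
  -- The product is split as `Φ'(uₙ)(gₙ - g) + Φ'(uₙ) g`. The first term vanishes in `L¹` on `K`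
  -- because `Φ'` is bounded; the second converges by domination, since `uₙ → u` almost everywhere.
  have t2 : Tendsto (fun n ↦ ∫ x, Φ' (mollify n u x) * mollify n (fun y ↦ g y i) x * φ x) atTop
      (𝓝 (∫ x, Φ' (u x) * g x i * φ x)) := by
    have hz : Tendsto (fun n ↦ ∫ x, (mollify n (fun y ↦ g y i) x - g x i) *
        (Φ' (mollify n u x) * φ x)) atTop (𝓝 0) := by
      refine tendsto_integral_mul_zero_of_setIntegral (M := M₂) hK
        (fun n ↦ (hG n).locallyIntegrable.sub hgi) (tendsto_setIntegral_abs_mollify_sub hgi hK)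
        (fun n x ↦ ?_) (fun n x hx ↦ by rw [hφ0 x hx, mul_zero])
      rw [abs_mul, ← one_mul M₂]
      exact mul_le_mul (hb _) (hM₂ x) (abs_nonneg _) zero_le_one
    have hd : Tendsto (fun n ↦ ∫ x, g x i * φ x * Φ' (mollify n u x)) atTop
        (𝓝 (∫ x, g x i * φ x * Φ' (u x))) := by
      refine tendsto_integral_of_dominated_convergence _
        (fun n ↦ (hbdd (hUi n).aestronglyMeasurable).aestronglyMeasurable) hgφ.norm
        (fun n ↦ Eventually.of_forall fun x ↦ ?_) ?_
      · rw [norm_mul]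
        exact mul_le_of_le_one_right (norm_nonneg _) (hb _)
      · filter_upwards [ae_tendsto_mollify hu] with x hx
        exact ((hΦ'.tendsto _).comp hx).const_mul _
    have hs := hz.add hd
    rw [zero_add] at hs
    have e1 : ∫ x, g x i * φ x * Φ' (u x) = ∫ x, Φ' (u x) * g x i * φ x := by
      congr 1 with x; ring
    rw [← e1]
    refine hs.congr fun n ↦ ?_
    rw [← integral_add ?_ (hbdd (hUi n).aestronglyMeasurable)]
    · congr 1 with x; ring
    · have c : Continuous fun x ↦ Φ' (mollify n u x) * φ x :=
        (hΦ'.comp (hU n).continuous).mul hφ.continuous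
      exact ((hG n).locallyIntegrable.sub hgi).integrable_mul_of_hasCompactSupport c hc.mul_left
  simp only [PiLp.smul_apply, smul_eq_mul]
  exact tendsto_nhds_unique t1 (t2.neg.congr fun n ↦ (parts n).symm)

theorem hasDerivAt_sq_max_zero (s : ℝ) :
    HasDerivAt (fun s : ℝ ↦ (max s 0) ^ 2) (2 * max s 0) s := by
  rcases lt_trichotomy s 0 with hs | rfl | hs
  · have : (fun s : ℝ ↦ (max s 0) ^ 2) =ᶠ[𝓝 s] fun _ ↦ 0 := by
      filter_upwards [Iio_mem_nhds hs] with t ht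
      rw [max_eq_right (le_of_lt ht)]; simp
    rw [max_eq_right hs.le, mul_zero]
    exact (hasDerivAt_const s (0 : ℝ)).congr_of_eventuallyEq this
  · rw [max_self, mul_zero, hasDerivAt_iff_isLittleO]
    simp only [max_self, ne_eq, OfNat.ofNat_ne_zero, not_false_eq_true, zero_pow, sub_zero,
      smul_zero]
    have h1 : (fun x : ℝ ↦ (max x 0) ^ 2) =O[𝓝 0] fun x ↦ x ^ 2 := by
      refine Asymptotics.IsBigO.of_bound 1 (Eventually.of_forall fun x ↦ ?_)
      rw [one_mul, norm_pow, norm_pow]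
      refine pow_le_pow_left₀ (norm_nonneg _) ?_ 2
      rcases le_total x 0 with hx | hx
      · simp [max_eq_right hx]
      · rw [max_eq_left hx]
    exact h1.trans_isLittleO (Asymptotics.isLittleO_pow_id one_lt_two)
  · have : (fun s : ℝ ↦ (max s 0) ^ 2) =ᶠ[𝓝 s] fun t ↦ t ^ 2 := by
      filter_upwards [Ioi_mem_nhds hs] with t ht
      rw [max_eq_left (le_of_lt ht)]
    rw [max_eq_left hs.le]
    simpa using (hasDerivAt_pow 2 s).congr_of_eventuallyEq this

theorem MeasureTheory.LocallyIntegrable.indicator_pos {u : E → ℝ} {g : E → E}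
    (hu : LocallyIntegrable u) (hg : LocallyIntegrable g) :
    LocallyIntegrable (Set.indicator {x | 0 < u x} g) := by
  refine hg.mono ?_ (Eventually.of_forall fun x ↦ norm_indicator_le_norm_self _ _)
  exact hg.aestronglyMeasurable.indicator₀
    (nullMeasurableSet_lt aemeasurable_const hu.aestronglyMeasurable.aemeasurable)

theorem MeasureTheory.LocallyIntegrable.max_zero {u : E → ℝ}
    (hu : LocallyIntegrable u) : LocallyIntegrable (fun x ↦ max (u x) 0) := by
  refine hu.mono (hu.aestronglyMeasurable.sup aestronglyMeasurable_const)
    (Eventually.of_forall fun x ↦ ?_)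
  rw [Real.norm_of_nonneg (le_max_right _ _)]
  exact max_le (le_abs_self _) (abs_nonneg _)

/-- The weak gradient of the positive part. -/
theorem HasWeakGradient.max_zero {u : E → ℝ} {g : E → E} (h : HasWeakGradient u g)
    (hu : LocallyIntegrable u) (hg : LocallyIntegrable g) :
    HasWeakGradient (fun x ↦ max (u x) 0) (indicator {x | 0 < u x} g) := by
  set η : ℕ → ℝ := fun k ↦ 1 / ((k : ℝ) + 1)
  have hη : ∀ k, 0 < η k := fun k ↦ by positivity
  have hη0 : Tendsto η atTop (𝓝 0) := tendsto_one_div_add_atTop_nhds_zero_nat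
  -- A `C¹` approximation of the positive part. Its derivative vanishes for `s ≤ 0` and tends to 1
  -- for `s > 0`, which is why the limit carries the indicator of the strict inequality.
  set Φ : ℕ → ℝ → ℝ := fun k s ↦ √((max s 0) ^ 2 + η k ^ 2) - η k
  set Φ' : ℕ → ℝ → ℝ := fun k s ↦ max s 0 / √((max s 0) ^ 2 + η k ^ 2)
  have hpos : ∀ k s, 0 < (max s 0) ^ 2 + η k ^ 2 := fun k s ↦ by have := hη k; positivity
  have hder : ∀ k s, HasDerivAt (Φ k) (Φ' k s) s := fun k s ↦ by
    have := (((hasDerivAt_sq_max_zero s).add_const (η k ^ 2)).sqrt (hpos k s).ne').sub_const (η k)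
    exact this.congr_deriv (mul_div_mul_left _ _ two_ne_zero)
  have hcont : ∀ k, Continuous (Φ' k) := fun k ↦ by
    have c : Continuous fun s : ℝ ↦ max s 0 := continuous_id.max continuous_const
    exact c.div (((c.pow 2).add continuous_const).sqrt) fun s ↦ (Real.sqrt_pos.2 (hpos k s)).ne'
  have hle : ∀ k s, |Φ' k s| ≤ 1 := fun k s ↦ by
    simp only [Φ']
    rw [abs_of_nonneg (div_nonneg (le_max_right _ _) (Real.sqrt_nonneg _)),
      div_le_one (Real.sqrt_pos.2 (hpos k s))]
    exact Real.le_sqrt_of_sq_le (by nlinarith [hη k])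
  have hΦle : ∀ k s, |Φ k s| ≤ |s| := fun k s ↦ by
    have h0 : max s 0 ≤ |s| := max_le (le_abs_self _) (abs_nonneg _)
    have h1 : √((max s 0) ^ 2 + η k ^ 2) ≤ max s 0 + η k := by
      refine Real.sqrt_le_iff.2 ⟨by have := hη k; positivity, ?_⟩
      nlinarith [mul_nonneg (le_max_right s 0) (hη k).le]
    have h2 : η k ≤ √((max s 0) ^ 2 + η k ^ 2) :=
      Real.le_sqrt_of_sq_le (by nlinarith [sq_nonneg (max s 0)])
    simp only [Φ]
    rw [abs_of_nonneg (by linarith)]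
    linarith
  have hsq : ∀ s, Tendsto (fun k ↦ √((max s 0) ^ 2 + η k ^ 2)) atTop (𝓝 (max s 0)) := fun s ↦ by
    have : Tendsto (fun k ↦ √((max s 0) ^ 2 + η k ^ 2)) atTop (𝓝 √((max s 0) ^ 2 + 0 ^ 2)) :=
      (tendsto_const_nhds.add (hη0.pow 2)).sqrt
    simpa [Real.sqrt_sq (le_max_right s 0)] using this
  have hΦlim : ∀ s, Tendsto (fun k ↦ Φ k s) atTop (𝓝 (max s 0)) := fun s ↦ by
    simpa using (hsq s).sub hη0
  intro φ hφ hc i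
  set e : E := EuclideanSpace.single i 1
  have i1 := integrable_mul_fderiv hu hφ hc e
  have i2 := integrable_coord_mul hg hφ hc i
  have hmu := hu.aestronglyMeasurable
  have t1 : Tendsto (fun k ↦ ∫ x, Φ k (u x) * fderiv ℝ φ x e) atTop
      (𝓝 (∫ x, max (u x) 0 * fderiv ℝ φ x e)) := by
    refine tendsto_integral_of_dominated_convergence _ (fun k ↦ ?_) i1.norm
      (fun k ↦ Eventually.of_forall fun x ↦ ?_) (Eventually.of_forall fun x ↦ ?_)
    · have hΦc : Continuous (Φ k) := continuous_iff_continuousAt.2 fun s ↦ (hder k s).continuousAt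
      exact (hΦc.comp_aestronglyMeasurable hmu).mul
        (continuous_fderiv_apply_const (hφ.of_le (by simp)) e).aestronglyMeasurable
    · rw [norm_mul, norm_mul]
      exact mul_le_mul_of_nonneg_right (hΦle k _) (norm_nonneg _)
    · exact (hΦlim _).mul_const _
  have t2 : Tendsto (fun k ↦ ∫ x, (Φ' k (u x) • g x) i * φ x) atTop
      (𝓝 (∫ x, (indicator {x | 0 < u x} g x) i * φ x)) := by
    refine tendsto_integral_of_dominated_convergence _ (fun k ↦ ?_) i2.norm
      (fun k ↦ Eventually.of_forall fun x ↦ ?_) (Eventually.of_forall fun x ↦ ?_)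
    · simp only [PiLp.smul_apply, smul_eq_mul]
      exact (((hcont k).comp_aestronglyMeasurable hmu).mul
        (locallyIntegrable_coord hg i).aestronglyMeasurable).mul
        hφ.continuous.aestronglyMeasurable
    · simp only [PiLp.smul_apply, smul_eq_mul]
      rw [mul_assoc, norm_mul]
      exact mul_le_of_le_one_left (norm_nonneg _) (hle k _)
    · simp only [PiLp.smul_apply, smul_eq_mul]
      refine Tendsto.mul_const _ ?_
      by_cases hx : 0 < u x
      · have hd : Tendsto (fun k ↦ Φ' k (u x)) atTop (𝓝 (max (u x) 0 / max (u x) 0)) :=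
          tendsto_const_nhds.div (hsq _) (by rw [max_eq_left hx.le]; exact hx.ne')
        rw [div_self (by rw [max_eq_left hx.le]; exact hx.ne')] at hd
        rw [indicator_of_mem (by exact hx)]
        simpa using hd.mul_const (g x i)
      · have hd : ∀ k, Φ' k (u x) = 0 := fun k ↦ by
          simp only [Φ']
          rw [max_eq_right (not_lt.1 hx), zero_div]
        rw [indicator_of_notMem (by exact hx)]
        simp [hd]
  exact tendsto_nhds_unique t1 (t2.neg.congr fun k ↦
    (h.comp_of_hasDerivAt hu hg (hder k) (hcont k) (hle k) φ hφ hc i).symm)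

/-- The weak gradient of `u = u⁺ - u⁻` computed from its two parts vanishes on `{u = 0}`, and weak
gradients are unique. -/
theorem HasWeakGradient.ae_eq_zero_of_eq_zero {u : E → ℝ} {g : E → E} (h : HasWeakGradient u g)
    (hu : LocallyIntegrable u) (hg : LocallyIntegrable g) : ∀ᵐ x, u x = 0 → g x = 0 := by
  have hp := h.max_zero hu hg
  have hn := h.neg.max_zero hu.neg hg.neg
  have hpi := hu.indicator_pos hg
  have hni := hu.neg.indicator_pos hg.neg
  have hs := hp.sub hn hu.max_zero hu.neg.max_zero hpi hni
  have hs' := hs.congr (u' := u) (Eventually.of_forall fun x ↦ ?_) (EventuallyEq.refl _ _)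
  · filter_upwards [h.ae_eq hs' hg (hpi.sub hni)] with x hx h0
    rw [hx, indicator_of_notMem, indicator_of_notMem, sub_zero] <;> simp [h0]
  · rcases le_total 0 (u x) with h | h
    · simp [h]
    · simp [h]

/-- A function with vanishing weak gradient is almost everywhere constant. -/
theorem HasWeakGradient.exists_ae_eq_const {u : E → ℝ} (hu : LocallyIntegrable u)
    (h : HasWeakGradient u fun _ ↦ 0) : ∃ c, ∀ᵐ x, u x = c := by
  have hconst : ∀ n x, mollify n u x = mollify n u 0 := fun n x ↦ by
    refine is_const_of_fderiv_eq_zero (𝕜 := ℝ)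
      ((contDiff_mollify n hu).differentiable (by simp)) (fun y ↦ ?_) x 0
    ext v
    rw [← (EuclideanSpace.basisFun (Fin d) ℝ).sum_repr v]
    simp only [map_sum, map_smul, EuclideanSpace.basisFun_apply, h.fderiv_mollify hu]
    simp [mollify_apply]
  have hlim := ae_tendsto_mollify hu
  obtain ⟨y, hy⟩ := hlim.exists
  refine ⟨u y, ?_⟩
  filter_upwards [hlim] with x hx
  refine tendsto_nhds_unique hx (hy.congr fun n ↦ ?_)
  rw [hconst n x, hconst n y]

/-- Product rule with a bounded Lipschitz factor. -/
theorem HasWeakGradient.lipschitz_mul {u : E → ℝ} {g : E → E} (h : HasWeakGradient u g)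
    (hu : LocallyIntegrable u) (hg : LocallyIntegrable g) {C M : ℝ≥0} {a : E → ℝ}
    (ha : LipschitzWith C a) (hM : ∀ x, |a x| ≤ M) :
    HasWeakGradient (fun x ↦ a x * u x) (fun x ↦ a x • g x + u x • gradient a x) := by
  intro φ hφ hc i
  obtain ⟨D, hD⟩ := ContDiff.lipschitzWith_of_hasCompactSupport hc hφ (by simp)
  obtain ⟨N, hN⟩ := hc.exists_bound_of_continuous hφ.continuous
  have hN0 : 0 ≤ N := (norm_nonneg _).trans (hN 0)
  -- The weak gradient of `u` is tested with `a φ`, which is only Lipschitz, so smooth test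
  -- functions would not suffice here.
  have hlip : LipschitzWith (M * D + ⟨N, hN0⟩ * C) fun x ↦ a x * φ x := by
    refine LipschitzWith.of_dist_le_mul fun x y ↦ ?_
    have h1 := ha.dist_le_mul x y
    have h2 := hD.dist_le_mul x y
    rw [Real.dist_eq] at h1 h2 ⊢
    push_cast
    calc |a x * φ x - a y * φ y| = |a x * (φ x - φ y) + φ y * (a x - a y)| := by ring_nf
      _ ≤ |a x| * |φ x - φ y| + |φ y| * |a x - a y| := by
        rw [← abs_mul, ← abs_mul]; exact abs_add_le _ _
      _ ≤ M * (D * dist x y) + N * (C * dist x y) := by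
        gcongr
        · exact hM x
        · exact hN y
      _ = (M * D + N * C) * dist x y := by ring
  have hcs : HasCompactSupport fun x ↦ a x * φ x := hc.mul_left
  have key := h.integral_mul_gradient hu hg hlip hcs i
  have hgrad : ∀ᵐ x, gradient (fun x ↦ a x * φ x) x i =
      a x * fderiv ℝ φ x (EuclideanSpace.single i 1) + φ x * gradient a x i := by
    filter_upwards [ha.ae_differentiableAt (μ := volume)] with x hx
    rw [gradient_apply, gradient_apply, fderiv_fun_mul hx (hφ.differentiable (by simp) x)]
    simp
  have i1 : Integrable fun x ↦ a x * u x * fderiv ℝ φ x (EuclideanSpace.single i 1) := by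
    have := (integrable_mul_fderiv hu hφ hc (EuclideanSpace.single i 1)).bdd_mul
      ha.continuous.aestronglyMeasurable (Eventually.of_forall hM)
    simpa only [mul_assoc] using this
  have hgb : ∀ x, ‖gradient a x i‖ ≤ C := fun x ↦
    (PiLp.norm_apply_le _ i).trans (ha.norm_gradient_le x)
  have i2 : Integrable fun x ↦ gradient a x i * (u x * φ x) :=
    (hu.integrable_mul_of_hasCompactSupport hφ.continuous hc).bdd_mul
      (locallyIntegrable_coord ha.locallyIntegrable_gradient i).aestronglyMeasurable
      (Eventually.of_forall hgb)
  have i3 : Integrable fun x ↦ a x * (g x i * φ x) :=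
    (integrable_coord_mul hg hφ hc i).bdd_mul
      ha.continuous.aestronglyMeasurable (Eventually.of_forall hM)
  have e1 : ∫ x, u x * gradient (fun x ↦ a x * φ x) x i =
      ∫ x, (a x * u x * fderiv ℝ φ x (EuclideanSpace.single i 1) +
        gradient a x i * (u x * φ x)) := by
    refine integral_congr_ae ?_
    filter_upwards [hgrad] with x hx
    rw [hx]; ring
  have e2 : ∫ x, g x i * (a x * φ x) = ∫ x, a x * (g x i * φ x) := by
    congr 1 with x; ring
  have e3 : ∫ x, (a x • g x + u x • gradient a x) i * φ x =
      ∫ x, (a x * (g x i * φ x) + gradient a x i * (u x * φ x)) := by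
    congr 1 with x
    simp only [PiLp.add_apply, PiLp.smul_apply, smul_eq_mul]; ring
  rw [e1, integral_add i1 i2, e2] at key
  rw [e3, integral_add i3 i2]
  linarith

end ChainRule

/-! ### Perimeter: invariance, duality and submodularity -/

section Perimeter

variable {d : ℕ}

local notation "E" => EuclideanSpace ℝ (Fin d)

theorem contDiff_coord {n : WithTop ℕ∞} {T : E → E} (hT : ContDiff ℝ n T) (i : Fin d) :
    ContDiff ℝ n fun x ↦ T x i :=
  (EuclideanSpace.proj i : E →L[ℝ] ℝ).contDiff.comp hT

theorem hasCompactSupport_coord {T : E → E} (hT : HasCompactSupport T) (i : Fin d) :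
    HasCompactSupport fun x ↦ T x i :=
  hT.comp_left (g := fun v : E ↦ v i) (by simp)

theorem divergence_eq_sum_fderiv_coord {T : E → E} (hT : ContDiff ℝ 1 T) (x : E) :
    divergence T x = ∑ i, fderiv ℝ (fun y ↦ T y i) x (EuclideanSpace.single i 1) := by
  refine Finset.sum_congr rfl fun i _ ↦ ?_
  have := (EuclideanSpace.proj i : E →L[ℝ] ℝ).hasFDerivAt.comp x
    (hT.differentiable (by simp) x).hasFDerivAt
  have e : fderiv ℝ (fun y ↦ T y i) x = _ := this.fderiv
  rw [e]
  simp

theorem continuous_divergence {T : E → E} (hT : ContDiff ℝ 1 T) : Continuous (divergence T) := by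
  simp_rw [funext (divergence_eq_sum_fderiv_coord hT)]
  exact continuous_finsetSum _ fun i _ ↦ continuous_fderiv_apply_const (contDiff_coord hT i) _

theorem hasCompactSupport_divergence {T : E → E} (hc : HasCompactSupport T) :
    HasCompactSupport (divergence T) :=
  (hc.fderiv (𝕜 := ℝ)).comp_left
    (g := fun L : E →L[ℝ] E ↦ ∑ i : Fin d, (L (EuclideanSpace.single i 1)) i) (by simp)

theorem integrable_divergence {T : E → E} (hT : ContDiff ℝ 1 T) (hc : HasCompactSupport T) :
    Integrable (divergence T) :=
  (continuous_divergence hT).integrable_of_hasCompactSupport (hasCompactSupport_divergence hc)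

theorem integral_mul_divergence {u : E → ℝ} {g : E → E} (h : HasWeakGradient u g)
    (hu : LocallyIntegrable u) (hg : LocallyIntegrable g) {T : E → E} (hT : ContDiff ℝ 1 T)
    (hc : HasCompactSupport T) :
    ∫ x, u x * divergence T x = - ∫ x, inner ℝ (g x) (T x) := by
  have e1 : ∀ x, u x * divergence T x =
      ∑ i, u x * fderiv ℝ (fun y ↦ T y i) x (EuclideanSpace.single i 1) := fun x ↦ by
    rw [divergence_eq_sum_fderiv_coord hT, Finset.mul_sum]
  have e2 : ∀ x, inner ℝ (g x) (T x) = ∑ i, g x i * T x i := fun x ↦ by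
    simp [PiLp.inner_apply, mul_comm]
  simp_rw [e1, e2]
  rw [integral_finsetSum, integral_finsetSum, ← Finset.sum_neg_distrib]
  · exact Finset.sum_congr rfl fun i _ ↦
      h.integral_mul_fderiv hu hg (contDiff_coord hT i) (hasCompactSupport_coord hc i) i
  · exact fun i _ ↦ (locallyIntegrable_coord hg i).integrable_mul_of_hasCompactSupport
      (contDiff_coord hT i).continuous (hasCompactSupport_coord hc i)
  · exact fun i _ ↦ hu.integrable_mul_of_hasCompactSupport
      (continuous_fderiv_apply_const (contDiff_coord hT i) _)
      ((hasCompactSupport_coord hc i).fderiv_apply (𝕜 := ℝ) _)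

theorem integral_mul_divergence_le {u : E → ℝ} {g : E → E} (h : HasWeakGradient u g)
    (hu : LocallyIntegrable u) (hg : Integrable g) {T : E → E} (hT : ContDiff ℝ 1 T)
    (hc : HasCompactSupport T) (h1 : ∀ x, ‖T x‖ ≤ 1) :
    ∫ x, u x * divergence T x ≤ ∫ x, ‖g x‖ := by
  rw [integral_mul_divergence h hu hg.locallyIntegrable hT hc, ← integral_neg]
  refine (Real.le_norm_self _).trans (norm_integral_le_of_norm_le hg.norm
    (Eventually.of_forall fun x ↦ ?_))
  rw [norm_neg]
  exact (norm_inner_le_norm _ _).trans (mul_le_of_le_one_right (norm_nonneg _) (h1 x))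

theorem ContDiff.hasWeakGradient {f : E → ℝ} (hf : ContDiff ℝ 1 f) :
    HasWeakGradient f (gradient f) := by
  intro φ hφ hc i
  simp_rw [gradient_apply]
  refine integral_mul_fderiv_eq_neg_fderiv_mul_of_integrable ?_ ?_ ?_ ?_ ?_
  · exact (continuous_fderiv_apply_const hf _).locallyIntegrable.integrable_mul_of_hasCompactSupport
      hφ.continuous hc
  · exact integrable_mul_fderiv hf.continuous.locallyIntegrable hφ hc _
  · exact hf.continuous.locallyIntegrable.integrable_mul_of_hasCompactSupport hφ.continuous hc
  · exact fun x _ ↦ hf.differentiable (by simp) x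
  · exact fun x _ ↦ hφ.differentiable (by simp) x

theorem mollify_coord (n : ℕ) {T : E → E} (hT : LocallyIntegrable T) (x : E) (i : Fin d) :
    mollify n T x i = mollify n (fun y ↦ T y i) x := by
  rw [mollify_apply, mollify_apply]
  exact ((EuclideanSpace.proj i : E →L[ℝ] ℝ).integral_comp_comm
    (integrable_mollify_integrand_left n hT x)).symm

theorem divergence_mollify (n : ℕ) {T : E → E} (hT : ContDiff ℝ 1 T) :
    divergence (mollify n T) = mollify n (divergence T) := by
  ext x
  have hTi := hT.continuous.locallyIntegrable (μ := volume)
  rw [divergence_eq_sum_fderiv_coord ((contDiff_mollify n hTi).of_le (by simp))]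
  have e : ∀ i, fderiv ℝ (fun y ↦ mollify n T y i) x (EuclideanSpace.single i 1) =
      mollify n (fun y ↦ fderiv ℝ (fun z ↦ T z i) y (EuclideanSpace.single i 1)) x := fun i ↦ by
    simp_rw [mollify_coord n hTi]
    rw [(contDiff_coord hT i).hasWeakGradient.fderiv_mollify
      (contDiff_coord hT i).continuous.locallyIntegrable n x i]
    simp_rw [gradient_apply]
  simp_rw [e, mollify_apply, divergence_eq_sum_fderiv_coord hT, Finset.smul_sum]
  exact (integral_finsetSum _ fun i _ ↦ integrable_mollify_integrand_left n
    (continuous_fderiv_apply_const (contDiff_coord hT i) _).locallyIntegrable x).symm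

theorem ofReal_integral_divergence_le_perimeter (A : Set E) {T : E → E} (hT : ContDiff ℝ 1 T)
    (hc : HasCompactSupport T) (h1 : ∀ x, ‖T x‖ ≤ 1) :
    ENNReal.ofReal (∫ x in A, divergence T x) ≤ perimeter A :=
  le_iSup₂_of_le T hT (le_iSup₂_of_le hc h1 le_rfl)

theorem integral_divergence_le_perimeter {A : Set E} (hA : perimeter A ≠ ⊤) {T : E → E}
    (hT : ContDiff ℝ 1 T) (hc : HasCompactSupport T) (h1 : ∀ x, ‖T x‖ ≤ 1) :
    ∫ x in A, divergence T x ≤ (perimeter A).toReal :=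
  (ENNReal.ofReal_le_iff_le_toReal hA).1 (ofReal_integral_divergence_le_perimeter A hT hc h1)

theorem perimeter_le_iff {A : Set E} {c : ℝ≥0∞} : perimeter A ≤ c ↔
    ∀ T : E → E, ContDiff ℝ 1 T → HasCompactSupport T → (∀ x, ‖T x‖ ≤ 1) →
      ENNReal.ofReal (∫ x in A, divergence T x) ≤ c := by
  simp [perimeter, iSup_le_iff]

theorem perimeter_congr {A B : Set E} (h : A =ᵐ[volume] B) : perimeter A = perimeter B := by
  simp_rw [perimeter, setIntegral_congr_set h]

theorem perimeter_preimage_add_right_le (A : Set E) (a : E) :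
    perimeter ((· + a) ⁻¹' A) ≤ perimeter A := by
  refine perimeter_le_iff.2 fun T hT hc h1 ↦ ?_
  have hT' : ContDiff ℝ 1 fun y ↦ T (y - a) := hT.comp (contDiff_id.sub contDiff_const)
  have hc' : HasCompactSupport fun y ↦ T (y - a) := hc.comp_homeomorph (Homeomorph.subRight a)
  refine le_of_eq_of_le ?_ (ofReal_integral_divergence_le_perimeter A hT' hc' fun x ↦ h1 _)
  congr 1
  have hdiv : ∀ x, divergence (fun y ↦ T (y - a)) x = divergence T (x - a) := fun x ↦ by
    simp only [divergence, fderiv_comp_sub]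
  simp_rw [hdiv]
  have := (measurePreserving_add_right (volume : Measure E) a).setIntegral_preimage_emb
    (measurableEmbedding_addRight a) (fun x ↦ divergence T (x - a)) A
  simpa using this

theorem perimeter_preimage_add_right (A : Set E) (a : E) :
    perimeter ((· + a) ⁻¹' A) = perimeter A := by
  refine le_antisymm (perimeter_preimage_add_right_le A a) ?_
  have := perimeter_preimage_add_right_le ((· + a) ⁻¹' A) (-a)
  simpa [preimage_preimage] using this

/-- The `L¹` norm of a vector field is the supremum of its pairings with smooth compactly supported
fields of norm at most one. -/
theorem integral_norm_le_of_forall_integral_inner_le {G : E → E} (hG : Integrable G) {M : ℝ}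
    (h : ∀ T : E → E, ContDiff ℝ 1 T → HasCompactSupport T → (∀ x, ‖T x‖ ≤ 1) →
      ∫ x, inner ℝ (G x) (T x) ≤ M) : ∫ x, ‖G x‖ ≤ M := by
  -- The optimal field pairs with `G` to `‖G‖`; mollifying and cutting off makes it admissible.
  -- Since `0⁻¹ = 0`, it vanishes where `G` does.
  set N : E → E := fun x ↦ ‖G x‖⁻¹ • G x
  have hN1 : ∀ x, ‖N x‖ ≤ 1 := fun x ↦ by
    simp only [N, norm_smul, norm_inv, norm_norm]
    exact inv_mul_le_one
  have hNi : LocallyIntegrable N := by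
    refine (memLp_top_of_bound ?_ 1 (Eventually.of_forall hN1)).locallyIntegrable le_top
    exact (hG.aestronglyMeasurable.norm.aemeasurable.inv.aestronglyMeasurable).smul
      hG.aestronglyMeasurable
  have hχ : ∀ n : ℕ, ∃ χ : E → ℝ, ContDiff ℝ ∞ χ ∧ HasCompactSupport χ ∧ (∀ x, ‖χ x‖ ≤ 1) ∧
      ∀ x, ‖x‖ ≤ n → χ x = 1 := fun n ↦ by
    let b : ContDiffBump (0 : E) := ⟨n + 1, n + 2, by positivity, by linarith⟩
    refine ⟨b, b.contDiff, b.hasCompactSupport, fun x ↦ ?_, fun x hx ↦ ?_⟩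
    · rw [Real.norm_of_nonneg b.nonneg]; exact b.le_one
    · refine b.one_of_mem_closedBall ?_
      rw [mem_closedBall_zero_iff]
      exact hx.trans (by change (n : ℝ) ≤ n + 1; linarith)
  choose χ hχs hχc hχ1 hχe using hχ
  have hm : ∀ n, ContDiff ℝ ∞ fun x ↦ χ n x • mollify n N x := fun n ↦
    (hχs n).smul (contDiff_mollify n hNi)
  have hb : ∀ n x, ‖χ n x • mollify n N x‖ ≤ 1 := fun n x ↦ by
    rw [norm_smul]
    exact mul_le_one₀ (hχ1 n x) (norm_nonneg _) (norm_mollify_le n hN1 x)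
  have key : Tendsto (fun n ↦ ∫ x, inner ℝ (G x) (χ n x • mollify n N x)) atTop
      (𝓝 (∫ x, inner ℝ (G x) (N x))) := by
    refine tendsto_integral_of_dominated_convergence (fun x ↦ ‖G x‖)
      (fun n ↦ hG.aestronglyMeasurable.inner (hm n).continuous.aestronglyMeasurable) hG.norm
      (fun n ↦ Eventually.of_forall fun x ↦ ?_) ?_
    · exact (norm_inner_le_norm _ _).trans (mul_le_of_le_one_right (norm_nonneg _) (hb n x))
    · filter_upwards [ae_tendsto_mollify hNi] with x hx
      refine Tendsto.inner tendsto_const_nhds (hx.congr' ?_)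
      filter_upwards [eventually_ge_atTop ⌈‖x‖⌉₊] with n hn
      rw [hχe n x ((Nat.le_ceil _).trans (by exact_mod_cast hn)), one_smul]
  have e : ∀ x, inner ℝ (G x) (N x) = ‖G x‖ := fun x ↦ by
    simp only [N, inner_smul_right, real_inner_self_eq_norm_sq]
    rcases eq_or_ne ‖G x‖ 0 with h0 | h0
    · simp [h0]
    · field_simp
  simp_rw [e] at key
  exact le_of_tendsto' key fun n ↦ h _ ((hm n).of_le (by simp)) (hχc n).smul_right (hb n)

theorem integrable_gradient_mollify (n : ℕ) {f : E → ℝ} (hf : Integrable f) :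
    Integrable (gradient (mollify n f)) := by
  have hc := hasCompactSupport_mollifier (d := d) n
  have h1 : ContDiff ℝ 1 (mollifier d n) := (contDiff_mollifier n).of_le (by simp)
  have hd : fderiv ℝ (mollify n f) = _ := funext fun x ↦
    (hc.hasFDerivAt_convolution_left (ContinuousLinearMap.lsmul ℝ ℝ) h1
      hf.locallyIntegrable x).fderiv
  have hi : Integrable (fderiv ℝ (mollify n f)) := by
    rw [hd]
    exact ((h1.continuous_fderiv (by simp)).integrable_of_hasCompactSupport
      (hc.fderiv (𝕜 := ℝ))).integrable_convolution _ hf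
  exact ((InnerProductSpace.toDual ℝ E).symm.toContinuousLinearEquiv.toContinuousLinearMap :
    StrongDual ℝ E →L[ℝ] E).integrable_comp hi

/-- Mollifying the indicator function of a set does not increase the total variation. -/
theorem integral_norm_gradient_mollify_indicator_le {A : Set E} (hA : MeasurableSet A)
    (hfin : volume A ≠ ⊤) (hP : perimeter A ≠ ⊤) (n : ℕ) :
    ∫ x, ‖gradient (mollify n (A.indicator fun _ ↦ (1 : ℝ))) x‖ ≤ (perimeter A).toReal := by
  have hi : Integrable (A.indicator fun _ ↦ (1 : ℝ)) :=
    (integrable_indicator_iff hA).2 (integrableOn_const hfin)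
  refine integral_norm_le_of_forall_integral_inner_le (integrable_gradient_mollify n hi)
    fun T hT hc h1 ↦ ?_
  have hsm := contDiff_mollify n hi.locallyIntegrable
  have hTn : ContDiff ℝ 1 fun x ↦ -T x := hT.neg
  have hcn : HasCompactSupport fun x ↦ -T x := hc.neg
  have e1 := integral_mul_divergence (hsm.of_le (by simp)).hasWeakGradient
    hsm.continuous.locallyIntegrable (integrable_gradient_mollify n hi).locallyIntegrable hTn hcn
  simp only [inner_neg_right, integral_neg, neg_neg] at e1
  have hTi : LocallyIntegrable fun x ↦ -T x := hTn.continuous.locallyIntegrable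
  -- The mollifier moves onto the test field, where it commutes with the divergence and preserves
  -- the bound by 1, so the mollified field still competes in `perimeter A`.
  rw [← e1, integral_mollify_mul n hi (integrable_divergence hTn hcn), ← divergence_mollify n hTn]
  have e2 : ∀ x, A.indicator (fun _ ↦ (1 : ℝ)) x * divergence (mollify n fun x ↦ -T x) x =
      A.indicator (divergence (mollify n fun x ↦ -T x)) x := fun x ↦ by
    by_cases hx : x ∈ A <;> simp [hx]
  simp_rw [e2]
  rw [integral_indicator hA]
  exact integral_divergence_le_perimeter hP ((contDiff_mollify n hTi).of_le (by simp))
    (hasCompactSupport_mollify n hcn) (norm_mollify_le n fun x ↦ by rw [norm_neg]; exact h1 x)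

/-- Submodularity of the perimeter, in terms of test fields. -/
theorem integral_divergence_union_add_inter_le {A B : Set E} (hA : MeasurableSet A)
    (hB : MeasurableSet B) (hAf : volume A ≠ ⊤) (hBf : volume B ≠ ⊤) (hPA : perimeter A ≠ ⊤)
    (hPB : perimeter B ≠ ⊤) {S T : E → E} (hS : ContDiff ℝ 1 S) (hSc : HasCompactSupport S)
    (hS1 : ∀ x, ‖S x‖ ≤ 1) (hT : ContDiff ℝ 1 T) (hTc : HasCompactSupport T)
    (hT1 : ∀ x, ‖T x‖ ≤ 1) :
    (∫ x in A ∪ B, divergence S x) + ∫ x in A ∩ B, divergence T x ≤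
      (perimeter A).toReal + (perimeter B).toReal := by
  have hi : ∀ {D : Set E}, MeasurableSet D → volume D ≠ ⊤ →
      Integrable (D.indicator fun _ ↦ (1 : ℝ)) := fun hD hf ↦
    (integrable_indicator_iff hD).2 (integrableOn_const hf)
  have hab : ∀ (D : Set E) (n : ℕ) (x : E), ‖mollify n (D.indicator fun _ ↦ (1 : ℝ)) x‖ ≤ 1 :=
    fun D n x ↦ norm_mollify_le n (fun y ↦ by by_cases hy : y ∈ D <;> simp [hy]) x
  have hae : ∀ {D : Set E}, MeasurableSet D → volume D ≠ ⊤ →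
      ∀ᵐ x, Tendsto (fun n ↦ mollify n (D.indicator fun _ ↦ (1 : ℝ)) x) atTop
        (𝓝 (D.indicator (fun _ ↦ (1 : ℝ)) x)) := fun hD hf ↦
    ae_tendsto_mollify (hi hD hf).locallyIntegrable
  set f : ℕ → E → ℝ := fun n ↦ mollify n (A.indicator fun _ ↦ 1)
  set g : ℕ → E → ℝ := fun n ↦ mollify n (B.indicator fun _ ↦ 1)
  have hf : ∀ n, ContDiff ℝ ∞ (f n) := fun n ↦ contDiff_mollify n (hi hA hAf).locallyIntegrable
  have hg : ∀ n, ContDiff ℝ ∞ (g n) := fun n ↦ contDiff_mollify n (hi hB hBf).locallyIntegrable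
  have dom : ∀ {R : E → E}, ContDiff ℝ 1 R → HasCompactSupport R → ∀ {D : Set E},
      MeasurableSet D → ∀ {a : ℕ → E → ℝ}, (∀ n, Continuous (a n)) → (∀ n x, |a n x| ≤ 3) →
      (∀ᵐ x, Tendsto (fun n ↦ a n x) atTop (𝓝 (D.indicator (fun _ ↦ (1 : ℝ)) x))) →
      Tendsto (fun n ↦ ∫ x, a n x * divergence R x) atTop (𝓝 (∫ x in D, divergence R x)) := by
    intro R hR hRc D hD a ha hb hlim
    have e : ∫ x in D, divergence R x =
        ∫ x, D.indicator (fun _ ↦ (1 : ℝ)) x * divergence R x := by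
      rw [← integral_indicator hD]
      congr 1 with x
      by_cases hx : x ∈ D <;> simp [hx]
    rw [e]
    refine tendsto_integral_of_dominated_convergence (fun x ↦ 3 * ‖divergence R x‖)
      (fun n ↦ (ha n).aestronglyMeasurable.mul (continuous_divergence hR).aestronglyMeasurable)
      ((integrable_divergence hR hRc).norm.const_mul 3)
      (fun n ↦ Eventually.of_forall fun x ↦ ?_) ?_
    · rw [norm_mul]
      exact mul_le_mul_of_nonneg_right (hb n x) (norm_nonneg _)
    · filter_upwards [hlim] with x hx using hx.mul_const _
  have hfb : ∀ n x, |f n x| ≤ 1 := hab A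
  have hgb : ∀ n x, |g n x| ≤ 1 := hab B
  have hmax : ∀ n x, |max (g n x - f n x) 0| ≤ 2 := fun n x ↦ by
    have := abs_le.1 (hfb n x)
    have := abs_le.1 (hgb n x)
    rw [abs_of_nonneg (le_max_right _ _)]
    exact max_le (by linarith) (by norm_num)
  -- This is `max (f n) (g n)`, converging to the indicator of the union; below, `g n - (g n - f n)⁺
  -- = min (f n) (g n)` approximates that of the intersection.
  have t1 := dom hS hSc (hA.union hB) (a := fun n x ↦ f n x + max (g n x - f n x) 0)
    (fun n ↦ (hf n).continuous.add (((hg n).continuous.sub (hf n).continuous).max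
      continuous_const))
    (fun n x ↦ (abs_add_le _ _).trans (by linarith [hfb n x, hmax n x])) (by
      filter_upwards [hae hA hAf, hae hB hBf] with x hxA hxB
      refine (hxA.add ((hxB.sub hxA).max tendsto_const_nhds)).trans (le_of_eq ?_)
      congr 1
      by_cases h1 : x ∈ A <;> by_cases h2 : x ∈ B <;> simp [h1, h2])
  have t2 := dom hT hTc (hA.inter hB) (a := fun n x ↦ g n x - max (g n x - f n x) 0)
    (fun n ↦ (hg n).continuous.sub (((hg n).continuous.sub (hf n).continuous).max
      continuous_const))
    (fun n x ↦ (abs_sub _ _).trans (by linarith [hgb n x, hmax n x])) (by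
      filter_upwards [hae hA hAf, hae hB hBf] with x hxA hxB
      refine (hxB.sub ((hxB.sub hxA).max tendsto_const_nhds)).trans (le_of_eq ?_)
      congr 1
      by_cases h1 : x ∈ A <;> by_cases h2 : x ∈ B <;> simp [h1, h2])
  refine le_of_tendsto' (t1.add t2) fun n ↦ ?_
  have hfi : Integrable (gradient (f n)) := integrable_gradient_mollify n (hi hA hAf)
  have hgi : Integrable (gradient (g n)) := integrable_gradient_mollify n (hi hB hBf)
  have hfl := (hf n).continuous.locallyIntegrable (μ := volume)
  have hgl := (hg n).continuous.locallyIntegrable (μ := volume)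
  have wf : HasWeakGradient (f n) _ := ((hf n).of_le (by simp)).hasWeakGradient
  have wg : HasWeakGradient (g n) _ := ((hg n).of_le (by simp)).hasWeakGradient
  have wgf := wg.sub wf hgl hfl hgi.locallyIntegrable hfi.locallyIntegrable
  have wp := wgf.max_zero (hgl.sub hfl) (hgi.sub hfi).locallyIntegrable
  have hpm : MeasurableSet {x | 0 < g n x - f n x} :=
    measurableSet_lt measurable_const ((hg n).continuous.sub (hf n).continuous).measurable
  have hpi : Integrable (indicator {x | 0 < g n x - f n x}
      fun x ↦ gradient (g n) x - gradient (f n) x) := (hgi.sub hfi).indicator hpm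
  have hpl : LocallyIntegrable fun x ↦ max (g n x - f n x) 0 := (hgl.sub hfl).max_zero
  have i1 := integral_mul_divergence_le
    (wf.add wp hfl hpl hfi.locallyIntegrable hpi.locallyIntegrable) (hfl.add hpl) (hfi.add hpi)
    hS hSc hS1
  have i2 := integral_mul_divergence_le
    (wg.sub wp hgl hpl hgi.locallyIntegrable hpi.locallyIntegrable) (hgl.sub hpl) (hgi.sub hpi)
    hT hTc hT1
  have nA := integral_norm_gradient_mollify_indicator_le hA hAf hPA n
  have nB := integral_norm_gradient_mollify_indicator_le hB hBf hPB n
  refine (add_le_add i1 i2).trans ((le_of_eq ?_).trans (add_le_add nA nB))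
  refine (integral_add (hfi.add hpi).norm (hgi.sub hpi).norm).symm.trans
    (Eq.trans ?_ (integral_add hfi.norm hgi.norm))
  -- At each point the gradients of maximum and minimum are those of `f n` and `g n` in one of the
  -- two orders, so the sums of norms agree.
  congr 1 with x
  by_cases hx : 0 < g n x - f n x
  · simp only [Pi.add_apply, Pi.sub_apply, indicator_of_mem (show x ∈ {x | 0 < g n x - f n x} from hx)]
    rw [add_sub_cancel, sub_sub_cancel, add_comm]
  · simp only [Pi.add_apply, Pi.sub_apply,
      indicator_of_notMem (show x ∉ {x | 0 < g n x - f n x} from hx)]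
    rw [add_zero, sub_zero]

end Perimeter

/-! ### Sets whose intersection does not increase perimeter -/

section DecreasesPerimeter

variable {d : ℕ}

local notation "E" => EuclideanSpace ℝ (Fin d)

/-- Intersecting with `A` does not increase the perimeter of measurable sets of finite measure. -/
def DecreasesPerimeter (A : Set E) : Prop :=
  ∀ B : Set E, MeasurableSet B → volume B ≠ ⊤ → perimeter (B ∩ A) ≤ perimeter B

theorem IsPerimeterSupersolution.decreasesPerimeter {Ω : Set E} (h : IsPerimeterSupersolution Ω)
    (hm : MeasurableSet Ω) : DecreasesPerimeter Ω := by
  intro B hB hBf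
  by_cases hPB : perimeter B = ⊤
  · simp [hPB]
  have hPΩ := h.perimeter_lt_top.ne
  rw [← ENNReal.ofReal_toReal hPB]
  refine perimeter_le_iff.2 fun T hT hTc hT1 ↦ ENNReal.ofReal_le_ofReal ?_
  -- With `T` fixed, the supremum over `S` bounds `P(B ∪ Ω)` from above; minimality bounds it below
  -- by `P(Ω)`, which then cancels.
  have key : ∀ S : E → E, ContDiff ℝ 1 S → HasCompactSupport S → (∀ x, ‖S x‖ ≤ 1) →
      ∫ x in B ∪ Ω, divergence S x ≤
        (perimeter B).toReal + (perimeter Ω).toReal - ∫ x in B ∩ Ω, divergence T x := by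
    intro S hS hSc hS1
    have := integral_divergence_union_add_inter_le hB hm hBf h.volume_lt_top.ne hPB hPΩ hS hSc hS1
      hT hTc hT1
    linarith
  have hle : perimeter (B ∪ Ω) ≤ ENNReal.ofReal
      ((perimeter B).toReal + (perimeter Ω).toReal - ∫ x in B ∩ Ω, divergence T x) :=
    perimeter_le_iff.2 fun S hS hSc hS1 ↦ ENNReal.ofReal_le_ofReal (key S hS hSc hS1)
  have h0 : 0 ≤ (perimeter B).toReal + (perimeter Ω).toReal - ∫ x in B ∩ Ω, divergence T x := by
    have := key (fun _ ↦ 0) contDiff_const HasCompactSupport.zero (by simp)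
    simpa [divergence] using this
  have hsup := h.perimeter_le (B ∪ Ω) (hB.union hm).nullMeasurableSet subset_union_right
    ((measure_union_lt_top hBf.lt_top h.volume_lt_top))
  have := ENNReal.toReal_le_of_le_ofReal h0 (hsup.trans hle)
  linarith

theorem DecreasesPerimeter.congr {A A' : Set E} (h : DecreasesPerimeter A)
    (hA : A =ᵐ[volume] A') : DecreasesPerimeter A' := fun B hB hBf ↦ by
  rw [perimeter_congr ((ae_eq_refl B).inter hA.symm)]
  exact h B hB hBf

theorem DecreasesPerimeter.preimage_add_right {A : Set E} (h : DecreasesPerimeter A) (a : E) :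
    DecreasesPerimeter ((· + a) ⁻¹' A) := fun B hB hBf ↦ by
  have e : B ∩ (· + a) ⁻¹' A = (· + a) ⁻¹' ((· + -a) ⁻¹' B ∩ A) := by
    ext x; simp
  have hm : MeasurableSet ((· + -a) ⁻¹' B) := measurable_add_const _ hB
  rw [e, perimeter_preimage_add_right, ← perimeter_preimage_add_right B (-a)]
  exact h _ hm (by rwa [measure_preimage_add_right])

/-- Countable intersections inherit the property by lower semicontinuity of the perimeter. -/
theorem DecreasesPerimeter.iInter {A : ℕ → Set E} (h : ∀ n, DecreasesPerimeter (A n))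
    (hm : ∀ n, MeasurableSet (A n)) : DecreasesPerimeter (⋂ n, A n) := by
  intro B hB hBf
  -- Finite intersections follow by iteration. For one fixed field the integrals over the decreasing
  -- sets converge, so the bound by `P(B)` passes to the limit.
  set C : ℕ → Set E := fun n ↦ B ∩ ⋂ k ∈ Finset.range n, A k
  have hCm : ∀ n, MeasurableSet (C n) := fun n ↦
    hB.inter (Finset.measurableSet_biInter _ fun k _ ↦ hm k)
  have hCP : ∀ n, perimeter (C n) ≤ perimeter B := by
    intro n
    induction n with
    | zero => simp [C]
    | succ n ih =>
      have e : C (n + 1) = C n ∩ A n := by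
        ext x
        simp only [C, mem_inter_iff, mem_iInter, Finset.mem_range, Order.lt_add_one_iff]
        constructor
        · exact fun hx ↦ ⟨⟨hx.1, fun k hk ↦ hx.2 k hk.le⟩, hx.2 n le_rfl⟩
        · rintro ⟨⟨hx, h1⟩, h2⟩
          refine ⟨hx, fun k hk ↦ ?_⟩
          rcases hk.lt_or_eq with hk | rfl
          exacts [h1 k hk, h2]
      rw [e]
      exact (h n (C n) (hCm n) (ne_top_of_le_ne_top hBf (measure_mono inter_subset_left))).trans ih
  have hC : B ∩ ⋂ n, A n = ⋂ n, C n := by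
    ext x
    simp only [C, mem_inter_iff, mem_iInter, Finset.mem_range]
    exact ⟨fun hx n ↦ ⟨hx.1, fun k _ ↦ hx.2 k⟩, fun hx ↦ ⟨(hx 0).1, fun n ↦
      (hx (n + 1)).2 n (Nat.lt_succ_self n)⟩⟩
  rw [hC]
  refine perimeter_le_iff.2 fun T hT hTc hT1 ↦ ?_
  have hanti : Antitone C := fun m n hmn ↦ inter_subset_inter_right _
    (biInter_subset_biInter_left fun k hk ↦ Finset.mem_coe.2
      (Finset.mem_range.2 ((Finset.mem_range.1 hk).trans_le hmn)))
  have hlim := tendsto_setIntegral_of_antitone hCm hanti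
    ⟨0, (integrable_divergence hT hTc).integrableOn⟩
  exact le_of_tendsto' (ENNReal.tendsto_ofReal hlim) fun n ↦
    (ofReal_integral_divergence_le_perimeter _ hT hTc hT1).trans (hCP n)

/-- The inner parallel sets of a set that decreases perimeters have the same property. -/
theorem DecreasesPerimeter.setOf_le_infDist {Ω : Set E} (h : DecreasesPerimeter Ω) (hΩ : IsOpen Ω)
    (hfin : volume Ω ≠ ⊤) (hne : Ωᶜ.Nonempty)
    (hpos : ∀ x ∉ Ω, ∀ r > 0, 0 < volume (ball x r \ Ω)) {t : ℝ} (ht : 0 < t) :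
    DecreasesPerimeter {x | t ≤ infDist x Ωᶜ} := by
  have : Nonempty (ball (0 : E) t) := ⟨⟨0, mem_ball_self ht⟩⟩
  -- `{δ ≥ t}` is the intersection of the translates `Ω - b` over `|b| < t`; a dense sequence of
  -- shifts will turn out to suffice up to a null set.
  set a : ℕ → E := fun n ↦ (TopologicalSpace.denseSeq (ball (0 : E) t) n : E)
  have hat : ∀ n, ‖a n‖ < t := fun n ↦
    mem_ball_zero_iff.1 (TopologicalSpace.denseSeq (ball (0 : E) t) n).2
  set A : Set E := ⋂ n, (· + a n) ⁻¹' Ω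
  have hpm : ∀ b : E, MeasurableSet ((· + b) ⁻¹' Ω) := fun b ↦
    measurable_add_const b hΩ.measurableSet
  have hA : MeasurableSet A := MeasurableSet.iInter fun n ↦ hpm _
  refine (DecreasesPerimeter.iInter (fun n ↦ h.preimage_add_right (a n))
    fun n ↦ hpm _).congr (A := A) ?_
  have hsub : {x | t ≤ infDist x Ωᶜ} ⊆ A := by
    intro x hx
    refine mem_iInter.2 fun n ↦ ?_
    by_contra hn
    have h1 : infDist x Ωᶜ ≤ dist x (x + a n) := infDist_le_dist_of_mem hn
    rw [dist_self_add_right] at h1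
    exact absurd ((hx.trans h1).trans_lt (hat n)) (lt_irrefl _)
  -- The measure of the symmetric difference of translates is continuous in the shift, so
  -- containment for the dense shifts gives containment up to a null set for each `b`.
  have hnull : ∀ b ∈ ball (0 : E) t, volume (A \ (· + b) ⁻¹' Ω) = 0 := by
    intro b hb
    have hcont : Tendsto (fun c : E ↦ volume (symmDiff ((· + c) ⁻¹' Ω) ((· + b) ⁻¹' Ω)))
        (𝓝 b) (𝓝 0) := by
      let F : C(E, C(E, E)) := ContinuousMap.curry ⟨fun p : E × E ↦ p.2 + p.1, by fun_prop⟩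
      exact tendsto_measure_symmDiff_preimage_nhds_zero (f := F) (g := F b) (F.continuous.tendsto b)
        (Eventually.of_forall fun c ↦ measurePreserving_add_right volume c)
        (measurePreserving_add_right volume b) hΩ.measurableSet.nullMeasurableSet hfin
    refine le_antisymm (ENNReal.le_of_forall_pos_le_add fun ε hε _ ↦ ?_) zero_le
    rw [zero_add]
    have hev : ∀ᶠ c in 𝓝 b, volume (symmDiff ((· + c) ⁻¹' Ω) ((· + b) ⁻¹' Ω)) < ε :=
      hcont.eventually (gt_mem_nhds (by exact_mod_cast hε))
    have hev' : ∀ᶠ c : ball (0 : E) t in 𝓝 ⟨b, hb⟩,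
        volume (symmDiff ((· + (c : E)) ⁻¹' Ω) ((· + b) ⁻¹' Ω)) < ε :=
      (continuous_subtype_val.tendsto (⟨b, hb⟩ : ball (0 : E) t)).eventually hev
    obtain ⟨n, hn⟩ := (TopologicalSpace.denseRange_denseSeq (ball (0 : E) t)).exists_mem_open
      isOpen_interior (⟨_, mem_interior_iff_mem_nhds.2 hev'⟩)
    have hn' := interior_subset hn
    refine (measure_mono ?_).trans (le_of_lt hn')
    intro x hx
    exact Or.inl ⟨mem_iInter.1 hx.1 n, hx.2⟩
  -- The exceptional null set above depends on `b`; Fubini exchanges the quantifiers.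
  have hprod : ∀ᵐ x : E, volume {b | x ∈ A ∧ b ∈ ball (0 : E) t ∧ x + b ∉ Ω} = 0 := by
    have hNm : MeasurableSet {p : E × E | p.2 ∈ A ∧ p.1 ∈ ball (0 : E) t ∧ p.2 + p.1 ∉ Ω} := by
      refine (measurable_snd hA).inter ((measurable_fst measurableSet_ball).inter ?_)
      exact (measurable_snd.add measurable_fst) hΩ.measurableSet.compl
    have h0 : ((volume : Measure E).prod (volume : Measure E))
        {p : E × E | p.2 ∈ A ∧ p.1 ∈ ball (0 : E) t ∧ p.2 + p.1 ∉ Ω} = 0 := by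
      rw [Measure.measure_prod_null hNm]
      refine Eventually.of_forall fun b ↦ ?_
      by_cases hb : b ∈ ball (0 : E) t
      · refine measure_mono_null ?_ (hnull b hb)
        exact fun x hx ↦ ⟨hx.1, hx.2.2⟩
      · refine measure_mono_null (t := ∅) ?_ measure_empty
        exact fun x hx ↦ hb hx.2.1
    have h1 : ((volume : Measure E).prod (volume : Measure E))
        {p : E × E | p.1 ∈ A ∧ p.2 ∈ ball (0 : E) t ∧ p.1 + p.2 ∉ Ω} = 0 := by
      rw [← Measure.prod_swap, Measure.map_apply measurable_swap (by
        refine (measurable_fst hA).inter ((measurable_snd measurableSet_ball).inter ?_)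
        exact (measurable_fst.add measurable_snd) hΩ.measurableSet.compl)]
      exact h0
    exact Measure.ae_ae_of_ae_prod (measure_eq_zero_iff_ae_notMem.1 h1) |>.mono fun x hx ↦
      measure_eq_zero_iff_ae_notMem.2 hx
  filter_upwards [hprod] with x hx
  refine propext ⟨fun hxA ↦ ?_, fun hxt ↦ hsub hxt⟩
  change t ≤ infDist x Ωᶜ
  -- If `δ x < t`, some `z ∉ Ω` lies within `t` of `x`. By `hpos` a small ball around `z` misses `Ω`
  -- in positive measure, giving too many shifts `b` with `x + b ∉ Ω`.
  by_contra hlt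
  obtain ⟨z, hz, hzt⟩ := (infDist_lt_iff hne).1 (not_le.1 hlt)
  have hp := hpos z hz (t - dist x z) (by linarith)
  rw [← measure_preimage_add volume x] at hp
  refine hp.ne' (measure_mono_null ?_ hx)
  rintro b ⟨hb1, hb2⟩
  refine ⟨hxA, ?_, hb2⟩
  rw [mem_ball_zero_iff]
  have := dist_triangle x z (x + b)
  rw [dist_self_add_right, dist_comm z] at this
  rw [mem_ball] at hb1
  linarith

end DecreasesPerimeter

/-! ### Half of the coarea formula and minimality of total variation -/

section Coarea

variable {d : ℕ}

local notation "E" => EuclideanSpace ℝ (Fin d)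

/-- The perimeter of a superlevel set is controlled by the energy in thin layers below it. -/
theorem perimeter_setOf_le_le_liminf {u : E → ℝ} {g : E → E} (h : HasWeakGradient u g)
    (hum : Measurable u) (hu : LocallyIntegrable u) (hg : Integrable g) (t : ℝ) :
    perimeter {x | t ≤ u x} ≤ liminf (fun n : ℕ ↦ ∫⁻ x,
      indicator {x | t - 1 / ((n : ℝ) + 1) < u x ∧ u x ≤ t}
        (fun x ↦ ENNReal.ofReal ((n : ℝ) + 1) * ‖g x‖ₑ) x) atTop := by
  refine perimeter_le_iff.2 fun T hT hTc hT1 ↦ ?_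
  -- A ramp in the values of `u`, rising from 0 at `t - 1/(n+1)` to 1 at `t`; it converges pointwise
  -- to the indicator of `{t ≤ u}`, and its gradient lives on the layer.
  set f : ℕ → E → ℝ := fun n x ↦
    ((n : ℝ) + 1) * (max (u x + (1 / ((n : ℝ) + 1) - t)) 0 - max (u x + -t) 0)
  set L : ℕ → Set E := fun n ↦ {x | t - 1 / ((n : ℝ) + 1) < u x ∧ u x ≤ t}
  have hN : ∀ n : ℕ, (0 : ℝ) < (n : ℝ) + 1 := fun n ↦ by positivity
  have hLm : ∀ n, MeasurableSet (L n) := fun n ↦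
    (measurableSet_lt measurable_const hum).inter (measurableSet_le hum measurable_const)
  have hshift : ∀ c : ℝ, LocallyIntegrable fun x ↦ u x + c := fun c ↦
    hu.add (locallyIntegrable_const c)
  have wf : ∀ n, HasWeakGradient (f n) (fun x ↦ ((n : ℝ) + 1) • (L n).indicator g x) := fun n ↦ by
    have w1 := (h.add_const hu hg.locallyIntegrable (1 / ((n : ℝ) + 1) - t)).max_zero
      (hshift _) hg.locallyIntegrable
    have w2 := (h.add_const hu hg.locallyIntegrable (-t)).max_zero
      (hshift _) hg.locallyIntegrable
    have w := (w1.sub w2 (hshift _).max_zero (hshift _).max_zero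
      ((hshift _).indicator_pos hg.locallyIntegrable)
      ((hshift _).indicator_pos hg.locallyIntegrable)).const_mul ((n : ℝ) + 1)
    refine w.congr (EventuallyEq.refl _ _) (Eventually.of_forall fun x ↦ ?_)
    have hp : 0 < 1 / ((n : ℝ) + 1) := one_div_pos.2 (hN n)
    simp only [L, indicator_apply, mem_ofPred_eq]
    congr 1
    by_cases h1 : t < u x
    · rw [if_pos (by linarith), if_pos (by linarith), if_neg (by rintro ⟨-, h2⟩; linarith), sub_self]
    · rw [if_neg (c := 0 < u x + -t) (by linarith), sub_zero]
      congr 1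
      exact propext ⟨fun h2 ↦ ⟨by linarith, not_lt.1 h1⟩, fun h2 ↦ by linarith [h2.1]⟩
  have hfl : ∀ n, LocallyIntegrable (f n) := fun n ↦
    ((hshift _).max_zero.sub (hshift _).max_zero).smul ((n : ℝ) + 1)
  have hgi : ∀ n : ℕ, Integrable fun x ↦ ((n : ℝ) + 1) • (L n).indicator g x := fun n ↦
    (hg.indicator (hLm n)).smul ((n : ℝ) + 1)
  have hb : ∀ n x, |f n x| ≤ 1 := fun n x ↦ by
    have hp : 0 < 1 / ((n : ℝ) + 1) := one_div_pos.2 (hN n)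
    have h1 : 0 ≤ max (u x + (1 / ((n : ℝ) + 1) - t)) 0 - max (u x + -t) 0 :=
      sub_nonneg.2 (max_le_max (by linarith) le_rfl)
    have h2 : max (u x + (1 / ((n : ℝ) + 1) - t)) 0 - max (u x + -t) 0 ≤ 1 / ((n : ℝ) + 1) := by
      rw [sub_le_iff_le_add]
      exact max_le (by linarith [le_max_left (u x + -t) 0]) (by linarith [le_max_right (u x + -t) 0])
    rw [abs_of_nonneg (mul_nonneg (hN n).le h1)]
    calc ((n : ℝ) + 1) * _ ≤ ((n : ℝ) + 1) * (1 / ((n : ℝ) + 1)) :=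
          mul_le_mul_of_nonneg_left h2 (hN n).le
      _ = 1 := mul_one_div_cancel (hN n).ne'
  have hlim : ∀ x, Tendsto (fun n ↦ f n x) atTop
      (𝓝 ({x | t ≤ u x}.indicator (fun _ ↦ (1 : ℝ)) x)) := fun x ↦ by
    by_cases hx : t ≤ u x
    · rw [indicator_of_mem (by exact hx)]
      refine tendsto_const_nhds.congr fun n ↦ ?_
      have hp : 0 < 1 / ((n : ℝ) + 1) := one_div_pos.2 (hN n)
      simp only [f]
      rw [max_eq_left (by linarith), max_eq_left (by linarith)]
      have := mul_one_div_cancel (hN n).ne'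
      linear_combination -this
    · rw [indicator_of_notMem (by exact hx)]
      rw [not_le] at hx
      refine tendsto_const_nhds.congr' ?_
      filter_upwards [(tendsto_one_div_add_atTop_nhds_zero_nat (𝕜 := ℝ)).eventually
        (gt_mem_nhds (sub_pos.2 hx))] with n hn
      simp only [f]
      rw [max_eq_right (by linarith), max_eq_right (by linarith)]
      simp
  have hSm : MeasurableSet {x | t ≤ u x} := measurableSet_le measurable_const hum
  have hT' : Tendsto (fun n ↦ ∫ x, f n x * divergence T x) atTop
      (𝓝 (∫ x in {x | t ≤ u x}, divergence T x)) := by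
    have e : ∫ x in {x | t ≤ u x}, divergence T x =
        ∫ x, {x | t ≤ u x}.indicator (fun _ ↦ (1 : ℝ)) x * divergence T x := by
      rw [← integral_indicator hSm]
      congr 1 with x
      by_cases hx : t ≤ u x <;> simp [hx]
    rw [e]
    refine tendsto_integral_of_dominated_convergence _ (fun n ↦
      (hfl n).aestronglyMeasurable.mul (continuous_divergence hT).aestronglyMeasurable)
      (integrable_divergence hT hTc).norm (fun n ↦ Eventually.of_forall fun x ↦ ?_)
      (Eventually.of_forall fun x ↦ (hlim x).mul_const _)
    rw [norm_mul]
    exact mul_le_of_le_one_left (norm_nonneg _) (hb n x)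
  rw [← (ENNReal.tendsto_ofReal hT').liminf_eq]
  refine liminf_le_liminf (Eventually.of_forall fun n ↦ ?_)
  refine (ENNReal.ofReal_le_ofReal (integral_mul_divergence_le (wf n) (hfl n) (hgi n) hT hTc
    hT1)).trans (le_of_eq ?_)
  rw [ofReal_integral_norm_eq_lintegral_enorm (hgi n)]
  congr 1 with x
  by_cases hx : x ∈ L n
  · rw [indicator_of_mem hx, indicator_of_mem (by exact hx), enorm_smul,
      Real.enorm_of_nonneg (hN n).le]
  · rw [indicator_of_notMem hx, indicator_of_notMem (by exact hx), smul_zero, enorm_zero]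

/-- One half of the coarea formula. -/
theorem lintegral_liminf_layers_le {u : E → ℝ} {g : E → E} (hum : Measurable u)
    (hg : Integrable g) :
    ∫⁻ t, liminf (fun n : ℕ ↦ ∫⁻ x, indicator {x | t - 1 / ((n : ℝ) + 1) < u x ∧ u x ≤ t}
        (fun x ↦ ENNReal.ofReal ((n : ℝ) + 1) * ‖g x‖ₑ) x) atTop ≤ ∫⁻ x, ‖g x‖ₑ := by
  have hN : ∀ n : ℕ, (0 : ℝ) < (n : ℝ) + 1 := fun n ↦ by positivity
  have hmeas : ∀ n : ℕ, AEMeasurable (Function.uncurry fun (t : ℝ) (x : E) ↦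
      indicator {x | t - 1 / ((n : ℝ) + 1) < u x ∧ u x ≤ t}
        (fun x ↦ ENNReal.ofReal ((n : ℝ) + 1) * ‖g x‖ₑ) x)
      ((volume : Measure ℝ).prod (volume : Measure E)) := fun n ↦ by
    have hS : MeasurableSet {p : ℝ × E | p.1 - 1 / ((n : ℝ) + 1) < u p.2 ∧ u p.2 ≤ p.1} :=
      (measurableSet_lt (measurable_fst.sub_const _) (hum.comp measurable_snd)).inter
        (measurableSet_le (hum.comp measurable_snd) measurable_fst)
    have hG : AEMeasurable (fun p : ℝ × E ↦ ENNReal.ofReal ((n : ℝ) + 1) * ‖g p.2‖ₑ)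
        ((volume : Measure ℝ).prod (volume : Measure E)) :=
      (hg.aestronglyMeasurable.enorm.comp_snd).const_mul _
    exact hG.indicator hS
  refine (lintegral_liminf_le' fun n ↦ (hmeas n).lintegral_prod_right').trans ?_
  -- After Fatou, Tonelli: for fixed `x` the levels `t` form an interval of length `1/(n+1)`,
  -- cancelling the factor `n + 1`.
  have hn : ∀ n : ℕ, ∫⁻ t, ∫⁻ x, indicator {x | t - 1 / ((n : ℝ) + 1) < u x ∧ u x ≤ t}
        (fun x ↦ ENNReal.ofReal ((n : ℝ) + 1) * ‖g x‖ₑ) x = ∫⁻ x, ‖g x‖ₑ := fun n ↦ by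
    rw [lintegral_lintegral_swap (hmeas n)]
    congr 1 with x
    have e : ∀ t : ℝ, indicator {x | t - 1 / ((n : ℝ) + 1) < u x ∧ u x ≤ t}
        (fun x ↦ ENNReal.ofReal ((n : ℝ) + 1) * ‖g x‖ₑ) x =
        indicator (Ico (u x) (u x + 1 / ((n : ℝ) + 1)))
          (fun _ ↦ ENNReal.ofReal ((n : ℝ) + 1) * ‖g x‖ₑ) t := fun t ↦ by
      simp only [indicator_apply, mem_ofPred_eq, mem_Ico]
      congr 1
      exact propext ⟨fun h ↦ ⟨h.2, by linarith [h.1]⟩, fun h ↦ ⟨by linarith [h.2], h.1⟩⟩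
    simp_rw [e]
    rw [lintegral_indicator measurableSet_Ico, setLIntegral_const, Real.volume_Ico,
      add_sub_cancel_left, mul_right_comm, ← ENNReal.ofReal_mul (hN n).le,
      mul_one_div_cancel (hN n).ne', ENNReal.ofReal_one, one_mul]
  exact ((liminf_congr (Eventually.of_forall hn)).trans (liminf_const _)).le

/-- If the superlevel sets of `δ` decrease perimeters, then `δ` has the least total variation among
all functions above it. -/
theorem integral_mul_divergence_le_of_decreasesPerimeter {δ u : E → ℝ} {g : E → E} {R : ℝ}
    (hδm : Measurable δ) (hδ0 : ∀ x, 0 ≤ δ x) (hδR : ∀ x, δ x ≤ R)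
    (hδ : ∀ t > 0, DecreasesPerimeter {x | t ≤ δ x}) (h : HasWeakGradient u g)
    (hum : Measurable u) (hu : LocallyIntegrable u) (hg : Integrable g) (hle : ∀ x, δ x ≤ u x)
    (hfin : ∀ t > 0, volume {x | t ≤ u x} ≠ ⊤) {T : E → E} (hT : ContDiff ℝ 1 T)
    (hTc : HasCompactSupport T) (hT1 : ∀ x, ‖T x‖ ≤ 1) :
    ∫ x, δ x * divergence T x ≤ ∫ x, ‖g x‖ := by
  have hdiv := integrable_divergence hT hTc
  have hint : Integrable (Function.uncurry fun (x : E) (t : ℝ) ↦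
      indicator {x | t ≤ δ x} (divergence T) x)
      ((volume : Measure E).prod (volume.restrict (Ioc 0 R))) := by
    have hS : MeasurableSet {p : E × ℝ | p.2 ≤ δ p.1} :=
      measurableSet_le measurable_snd (hδm.comp measurable_fst)
    have h1 : Integrable (fun p : E × ℝ ↦ divergence T p.1)
        ((volume : Measure E).prod (volume.restrict (Ioc 0 R))) := hdiv.comp_fst _
    exact h1.indicator hS
  -- Layer-cake formula; the levels may be restricted to `(0, R]` because `0 ≤ δ ≤ R`.
  have e1 : ∫ x, δ x * divergence T x =
      ∫ t in Ioc 0 R, ∫ x in {x | t ≤ δ x}, divergence T x := by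
    have hsw := integral_integral_swap hint
    have e2 : ∀ x, ∫ t in Ioc 0 R, indicator {x | t ≤ δ x} (divergence T) x =
        δ x * divergence T x := fun x ↦ by
      have e3 : ∀ t : ℝ, indicator {x | t ≤ δ x} (divergence T) x =
          indicator (Iic (δ x)) (fun _ ↦ divergence T x) t := fun t ↦ by
        simp only [indicator_apply, mem_ofPred_eq, mem_Iic]
      simp_rw [e3]
      rw [setIntegral_indicator measurableSet_Iic, Ioc_inter_Iic, min_eq_right (hδR x),
        setIntegral_const, smul_eq_mul, Real.volume_real_Ioc_of_le (hδ0 x), sub_zero]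
    simp_rw [e2] at hsw
    rw [hsw]
    refine integral_congr_ae (Eventually.of_forall fun t ↦ ?_)
    exact integral_indicator (measurableSet_le measurable_const hδm)
  have hq : Integrable (fun t ↦ ∫ x in {x | t ≤ δ x}, divergence T x)
      (volume.restrict (Ioc 0 R)) := by
    refine hint.integral_prod_right.congr (Eventually.of_forall fun t ↦ ?_)
    exact integral_indicator (measurableSet_le measurable_const hδm)
  have key : ENNReal.ofReal (∫ x, δ x * divergence T x) ≤ ENNReal.ofReal (∫ x, ‖g x‖) := by
    rw [e1, ofReal_integral_norm_eq_lintegral_enorm hg]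
    refine le_trans ?_ (lintegral_liminf_layers_le hum hg)
    refine le_trans ?_ (setLIntegral_le_lintegral (Ioc 0 R) _)
    refine le_trans (b := ∫⁻ t in Ioc 0 R,
      ENNReal.ofReal (∫ x in {x | t ≤ δ x}, divergence T x)) ?_ ?_
    · refine (ENNReal.ofReal_le_ofReal (integral_mono hq hq.pos_part fun t ↦
        le_max_left _ _)).trans (le_of_eq ?_)
      rw [ofReal_integral_eq_lintegral_ofReal hq.pos_part
        (Eventually.of_forall fun t ↦ le_max_right _ _)]
      simp
    · refine setLIntegral_mono' measurableSet_Ioc fun t ht ↦ ?_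
      -- The superlevel set of `δ` is cut out of that of `u`, so `DecreasesPerimeter` compares their
      -- perimeters.
      have hsub : {x | t ≤ u x} ∩ {x | t ≤ δ x} = {x | t ≤ δ x} :=
        inter_eq_right.2 fun x hx ↦ le_trans hx (hle x)
      have hd := hδ t ht.1 {x | t ≤ u x} (measurableSet_le measurable_const hum) (hfin t ht.1)
      rw [hsub] at hd
      exact ((ofReal_integral_divergence_le_perimeter _ hT hTc hT1).trans hd).trans
        (perimeter_setOf_le_le_liminf h hum hu hg t)
  exact (ENNReal.ofReal_le_ofReal_iff (integral_nonneg fun x ↦ norm_nonneg _)).1 key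

end Coarea

/-! ### The Sobolev-like space: integrability, lattice operations, uniqueness -/

section SobolevLike

variable {d : ℕ}

local notation "E" => EuclideanSpace ℝ (Fin d)

theorem MeasureTheory.MemLp.integrable_inner_of_two {f g : E → E} (hf : MemLp f 2)
    (hg : MemLp g 2) : Integrable fun x ↦ inner ℝ (f x) (g x) :=
  (hf.norm.integrable_mul hg.norm).mono'
    (hf.aestronglyMeasurable.inner hg.aestronglyMeasurable)
    (Eventually.of_forall fun _ ↦ norm_inner_le_norm _ _)

theorem integrable_of_memLp_two_of_ae_eq_zero {F : Type*} [NormedAddCommGroup F] {Ω : Set E}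
    (hm : MeasurableSet Ω) (hfin : volume Ω ≠ ⊤) {f : E → F} (hf : MemLp f 2)
    (h0 : ∀ᵐ x, x ∉ Ω → f x = 0) : Integrable f := by
  have : IsFiniteMeasure (volume.restrict Ω) := isFiniteMeasure_restrict.2 hfin
  have h1 : IntegrableOn f Ω := (hf.restrict Ω).integrable one_le_two
  refine (h1.integrable_indicator hm).congr ?_
  filter_upwards [h0] with x hx
  by_cases hxΩ : x ∈ Ω
  · rw [indicator_of_mem hxΩ]
  · rw [indicator_of_notMem hxΩ, hx hxΩ]

theorem memLp_of_bound_of_eq_zero {F : Type*} [NormedAddCommGroup F] {Ω : Set E}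
    (hm : MeasurableSet Ω) (hfin : volume Ω ≠ ⊤) {f : E → F} {C : ℝ}
    (hf : AEStronglyMeasurable f) (hb : ∀ x, ‖f x‖ ≤ C)
    (h0 : ∀ x ∉ Ω, f x = 0) (p : ℝ≥0∞) : MemLp f p := by
  have : IsFiniteMeasure (volume.restrict Ω) := isFiniteMeasure_restrict.2 hfin
  have e : f = Ω.indicator f := by
    ext x
    by_cases hx : x ∈ Ω
    · rw [indicator_of_mem hx]
    · rw [indicator_of_notMem hx, h0 x hx]
  rw [e, memLp_indicator_iff_restrict hm]
  exact MemLp.of_bound hf.restrict C (Eventually.of_forall hb)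

namespace MemSobolevLike

variable {Ω : Set (EuclideanSpace ℝ (Fin d))} {u v : EuclideanSpace ℝ (Fin d) → ℝ}
  {g h : EuclideanSpace ℝ (Fin d) → EuclideanSpace ℝ (Fin d)}

theorem locallyIntegrable (hu : MemSobolevLike Ω u g) : LocallyIntegrable u :=
  hu.memLp.locallyIntegrable one_le_two

theorem locallyIntegrable_grad (hu : MemSobolevLike Ω u g) : LocallyIntegrable g :=
  hu.memLp_grad.locallyIntegrable one_le_two

theorem grad_ae_eq_zero (hu : MemSobolevLike Ω u g) : ∀ᵐ x, x ∉ Ω → g x = 0 := by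
  filter_upwards [hu.ae_eq_zero, hu.hasWeakGradient.ae_eq_zero_of_eq_zero hu.locallyIntegrable
    hu.locallyIntegrable_grad] with x h1 h2 hx using h2 (h1 hx)

theorem integrable (hu : MemSobolevLike Ω u g) (hm : MeasurableSet Ω) (hfin : volume Ω ≠ ⊤) :
    Integrable u :=
  integrable_of_memLp_two_of_ae_eq_zero hm hfin hu.memLp hu.ae_eq_zero

theorem integrable_grad (hu : MemSobolevLike Ω u g) (hm : MeasurableSet Ω)
    (hfin : volume Ω ≠ ⊤) : Integrable g :=
  integrable_of_memLp_two_of_ae_eq_zero hm hfin hu.memLp_grad hu.grad_ae_eq_zero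

theorem congr (hu : MemSobolevLike Ω u g) (huv : u =ᵐ[volume] v) (hgh : g =ᵐ[volume] h) :
    MemSobolevLike Ω v h where
  memLp := hu.memLp.ae_eq huv
  memLp_grad := hu.memLp_grad.ae_eq hgh
  hasWeakGradient := hu.hasWeakGradient.congr huv hgh
  ae_eq_zero := by
    filter_upwards [hu.ae_eq_zero, huv] with x h1 h2 hx
    rw [← h2, h1 hx]

theorem sub (hu : MemSobolevLike Ω u g) (hv : MemSobolevLike Ω v h) :
    MemSobolevLike Ω (fun x ↦ u x - v x) (fun x ↦ g x - h x) where
  memLp := hu.memLp.sub hv.memLp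
  memLp_grad := hu.memLp_grad.sub hv.memLp_grad
  hasWeakGradient := hu.hasWeakGradient.sub hv.hasWeakGradient hu.locallyIntegrable
    hv.locallyIntegrable hu.locallyIntegrable_grad hv.locallyIntegrable_grad
  ae_eq_zero := by
    filter_upwards [hu.ae_eq_zero, hv.ae_eq_zero] with x h1 h2 hx
    rw [h1 hx, h2 hx, sub_zero]

theorem neg (hu : MemSobolevLike Ω u g) :
    MemSobolevLike Ω (fun x ↦ -u x) (fun x ↦ -g x) where
  memLp := hu.memLp.neg
  memLp_grad := hu.memLp_grad.neg
  hasWeakGradient := hu.hasWeakGradient.neg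
  ae_eq_zero := by
    filter_upwards [hu.ae_eq_zero] with x h1 hx
    rw [h1 hx, neg_zero]

theorem max_zero (hu : MemSobolevLike Ω u g) :
    MemSobolevLike Ω (fun x ↦ max (u x) 0) (indicator {x | 0 < u x} g) where
  memLp := hu.memLp.mono hu.locallyIntegrable.max_zero.aestronglyMeasurable
    (Eventually.of_forall fun x ↦ by
      rw [Real.norm_of_nonneg (le_max_right _ _)]
      exact max_le (le_abs_self _) (abs_nonneg _))
  memLp_grad := hu.memLp_grad.mono
    (hu.locallyIntegrable.indicator_pos hu.locallyIntegrable_grad).aestronglyMeasurable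
    (Eventually.of_forall fun x ↦ norm_indicator_le_norm_self _ _)
  hasWeakGradient := hu.hasWeakGradient.max_zero hu.locallyIntegrable hu.locallyIntegrable_grad
  ae_eq_zero := by
    filter_upwards [hu.ae_eq_zero] with x h1 hx
    rw [h1 hx, max_self]

/-- A vanishing gradient makes `u` constant, and the constant is 0 because `u` vanishes on a set of
positive measure. This replaces a Poincaré inequality in all comparison arguments. -/
theorem ae_eq_zero_of_grad (hu : MemSobolevLike Ω u g) (hΩ : volume Ωᶜ ≠ 0)
    (hg : ∀ᵐ x, g x = 0) : ∀ᵐ x, u x = 0 := by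
  obtain ⟨c, hc⟩ := (hu.hasWeakGradient.congr (EventuallyEq.refl _ _) hg).exists_ae_eq_const
    hu.locallyIntegrable
  obtain ⟨x, hx, h1, h2⟩ : ∃ x, x ∉ Ω ∧ u x = c ∧ (x ∉ Ω → u x = 0) := by
    by_contra hn
    push Not at hn
    apply hΩ
    rw [measure_eq_zero_iff_ae_notMem]
    filter_upwards [hc, hu.ae_eq_zero] with x h1 h2 hx
    exact (hn x hx h1).2 (h2 hx)
  filter_upwards [hc] with y hy
  rw [hy, ← h1, h2 hx]

theorem ae_eq_zero_of_integral_norm_sq_nonpos (hu : MemSobolevLike Ω u g) (hΩ : volume Ωᶜ ≠ 0)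
    (hg : ∫ x, ‖g x‖ ^ 2 ≤ 0) : ∀ᵐ x, u x = 0 := by
  refine hu.ae_eq_zero_of_grad hΩ ?_
  have h0 : 0 ≤ᵐ[volume] fun x ↦ ‖g x‖ ^ 2 := Eventually.of_forall fun x ↦ sq_nonneg _
  have := (integral_eq_zero_iff_of_nonneg_ae h0
    ((memLp_two_iff_integrable_sq_norm hu.memLp_grad.1).1 hu.memLp_grad)).1
    (le_antisymm hg (integral_nonneg_of_ae h0))
  filter_upwards [this] with x hx
  simpa using hx

end MemSobolevLike

end SobolevLike

/-! ### The distance to the complement and its gradient -/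

section Distance

variable {d : ℕ} {Ω : Set (EuclideanSpace ℝ (Fin d))}

local notation "E" => EuclideanSpace ℝ (Fin d)

/-- Points of `Ωᶜ` are minima of the distance. Where it is not differentiable, the default
derivative 0 gives the claim, so no null set is excluded. -/
theorem gradient_infDist_compl_eq_zero {x : E} (hx : x ∉ Ω) :
    gradient (fun y ↦ infDist y Ωᶜ) x = 0 := by
  have h0 : infDist x Ωᶜ = 0 := infDist_zero_of_mem hx
  have hmin : IsLocalMin (fun y ↦ infDist y Ωᶜ) x :=
    Eventually.of_forall fun y ↦ by simp only [h0]; exact infDist_nonneg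
  rw [gradient, hmin.fderiv_eq_zero, map_zero]

theorem norm_gradient_infDist_le (x : E) : ‖gradient (fun y ↦ infDist y Ωᶜ) x‖ ≤ 1 := by
  simpa using (lipschitz_infDist_pt Ωᶜ).norm_gradient_le x

/-- Along the segment to a nearest point of `Ωᶜ` the distance decreases at unit speed;
Cauchy–Schwarz turns this slope into the lower bound for the gradient. -/
theorem norm_gradient_infDist_eq_one (hΩ : IsOpen Ω) (hne : Ωᶜ.Nonempty) {x : E} (hx : x ∈ Ω)
    (hd : DifferentiableAt ℝ (fun y ↦ infDist y Ωᶜ) x) :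
    ‖gradient (fun y ↦ infDist y Ωᶜ) x‖ = 1 := by
  refine le_antisymm (norm_gradient_infDist_le x) ?_
  obtain ⟨z, hz, hxz⟩ := hΩ.isClosed_compl.exists_infDist_eq_dist hne x
  have hpos : 0 < ‖z - x‖ := norm_pos_iff.2 (sub_ne_zero.2 fun h ↦ hz (h ▸ hx))
  have hline : ∀ s ∈ Icc (0 : ℝ) 1, infDist (x + s • (z - x)) Ωᶜ = (1 - s) * ‖z - x‖ := by
    intro s hs
    refine le_antisymm ?_ ?_
    · refine (infDist_le_dist_of_mem hz).trans (le_of_eq ?_)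
      rw [dist_comm, dist_eq_norm, show z - (x + s • (z - x)) = (1 - s) • (z - x) by module,
        norm_smul, Real.norm_of_nonneg (by linarith [hs.2])]
    · have := infDist_le_infDist_add_dist (s := Ωᶜ) (x := x) (y := x + s • (z - x))
      rw [hxz, dist_self_add_right, norm_smul, Real.norm_of_nonneg hs.1, dist_comm,
        dist_eq_norm] at this
      linarith
  have h1 : HasDerivWithinAt (fun s : ℝ ↦ infDist (x + s • (z - x)) Ωᶜ)
      (fderiv ℝ (fun y ↦ infDist y Ωᶜ) x (z - x)) (Icc 0 1) 0 := by
    have hl : HasDerivAt (fun s : ℝ ↦ x + s • (z - x)) (z - x) 0 := by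
      simpa using ((hasDerivAt_id (0 : ℝ)).smul_const (z - x)).const_add x
    have hd' : HasFDerivAt (fun y ↦ infDist y Ωᶜ) (fderiv ℝ (fun y ↦ infDist y Ωᶜ) x)
        (x + (0 : ℝ) • (z - x)) := by
      simpa using hd.hasFDerivAt
    exact (hd'.comp_hasDerivAt (0 : ℝ) hl).hasDerivWithinAt
  have h2 : HasDerivWithinAt (fun s : ℝ ↦ infDist (x + s • (z - x)) Ωᶜ)
      (-‖z - x‖) (Icc 0 1) 0 := by
    have : HasDerivAt (fun s : ℝ ↦ (1 - s) * ‖z - x‖) (-‖z - x‖) 0 := by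
      simpa using ((hasDerivAt_id (0 : ℝ)).const_sub 1).mul_const ‖z - x‖
    exact this.hasDerivWithinAt.congr hline (hline 0 ⟨le_rfl, zero_le_one⟩)
  have heq := (uniqueDiffOn_Icc zero_lt_one 0 ⟨le_rfl, zero_le_one⟩).eq_deriv _ h1 h2
  rw [← inner_gradient_left] at heq
  have hcs := abs_real_inner_le_norm (gradient (fun y ↦ infDist y Ωᶜ) x) (z - x)
  rw [heq, abs_neg, abs_norm] at hcs
  exact le_of_mul_le_mul_right (by linarith) hpos

theorem ae_norm_gradient_infDist_eq_one (hΩ : IsOpen Ω) (hne : Ωᶜ.Nonempty) :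
    ∀ᵐ x : E, x ∈ Ω → ‖gradient (fun y ↦ infDist y Ωᶜ) x‖ = 1 := by
  filter_upwards [(lipschitz_infDist_pt Ωᶜ).ae_differentiableAt (μ := volume)] with x hd hx
  exact norm_gradient_infDist_eq_one hΩ hne hx hd

/-- The ball of radius `infDist x Ωᶜ` around `x` lies in `Ω`, and large balls have more volume than
`Ω`. -/
theorem exists_forall_infDist_le (hfin : volume Ω ≠ ⊤)
    (huniv : volume (univ : Set E) = ⊤) : ∃ R : ℝ, 0 < R ∧ ∀ x : E, infDist x Ωᶜ ≤ R := by
  have hlim : Tendsto (fun n : ℕ ↦ volume (ball (0 : E) n)) atTop (𝓝 ⊤) := by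
    have := tendsto_measure_iUnion_atTop (μ := volume) (s := fun n : ℕ ↦ ball (0 : E) n)
      fun m n hmn ↦ ball_subset_ball (by exact_mod_cast hmn)
    rwa [iUnion_ball_nat, huniv] at this
  obtain ⟨n, hn, hn0⟩ := ((hlim.eventually (lt_mem_nhds hfin.lt_top)).and
    (eventually_gt_atTop 0)).exists
  refine ⟨n, by exact_mod_cast hn0, fun x ↦ ?_⟩
  by_contra hx
  rw [not_le] at hx
  refine absurd hn (not_lt.2 ?_)
  have hsub : ball x n ⊆ Ω := by
    intro y hy
    by_contra hyΩ
    have := infDist_le_dist_of_mem (x := x) (show y ∈ Ωᶜ from hyΩ)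
    rw [mem_ball, dist_comm] at hy
    linarith
  calc volume (ball (0 : E) n) = volume (ball x n) := by
        rw [← Measure.addHaar_ball_center volume x]
    _ ≤ volume Ω := measure_mono hsub

end Distance

/-! ### Superharmonicity of the distance function -/

section Superharmonic

variable {d : ℕ} {Ω : Set (EuclideanSpace ℝ (Fin d))}

local notation "E" => EuclideanSpace ℝ (Fin d)

theorem memLp_gradient_infDist (hΩ : IsOpen Ω) (hfin : volume Ω ≠ ⊤) (p : ℝ≥0∞) :
    MemLp (gradient fun y : E ↦ infDist y Ωᶜ) p :=
  memLp_of_bound_of_eq_zero hΩ.measurableSet hfin (measurable_gradient _).aestronglyMeasurable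
    norm_gradient_infDist_le (fun _ hx ↦ gradient_infDist_compl_eq_zero hx) p

/-- The distance to the complement minimizes the total variation among nonnegative perturbations
vanishing outside of `Ω`. -/
theorem integral_norm_gradient_infDist_le {R : ℝ} (hΩ : IsOpen Ω) (hfin : volume Ω ≠ ⊤)
    (hne : Ωᶜ.Nonempty) (hpos : ∀ x ∉ Ω, ∀ r > 0, 0 < volume (ball x r \ Ω))
    (hdec : DecreasesPerimeter Ω) (hR : ∀ x : E, infDist x Ωᶜ ≤ R) {v : E → ℝ} {h : E → E}
    (hv : MemSobolevLike Ω v h) (hv0 : ∀ᵐ x, 0 ≤ v x) {ε : ℝ} (hε : 0 ≤ ε) :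
    ∫ x, ‖gradient (fun y ↦ infDist y Ωᶜ) x‖ ≤
      ∫ x, ‖gradient (fun y ↦ infDist y Ωᶜ) x + ε • h x‖ := by
  set δ : E → ℝ := fun y ↦ infDist y Ωᶜ
  have hδl : LipschitzWith 1 δ := lipschitz_infDist_pt Ωᶜ
  have hδi : Integrable (gradient δ) := memLp_one_iff_integrable.1 (memLp_gradient_infDist hΩ hfin 1)
  have hhi := hv.integrable_grad hΩ.measurableSet hfin
  -- A representative nonnegative everywhere, so that `δ ≤ δ + ε v'` holds pointwise and superlevel
  -- sets are measurable.
  obtain ⟨v', hv'm, hv'0, hvv'⟩ : ∃ v' : E → ℝ, Measurable v' ∧ (∀ x, 0 ≤ v' x) ∧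
      v =ᵐ[volume] v' := by
    refine ⟨fun x ↦ max (hv.memLp.1.mk v x) 0,
      hv.memLp.1.stronglyMeasurable_mk.measurable.max measurable_const,
      fun x ↦ le_max_right _ _, ?_⟩
    filter_upwards [hv0, hv.memLp.1.ae_eq_mk] with x h1 h2
    rw [← h2, max_eq_left h1]
  have hv' := hv.congr hvv' (EventuallyEq.refl _ _)
  have hw : HasWeakGradient (fun x ↦ δ x + ε * v' x) (fun x ↦ gradient δ x + ε • h x) :=
    hδl.hasWeakGradient.add (hv'.hasWeakGradient.const_mul ε) hδl.continuous.locallyIntegrable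
      (hv'.locallyIntegrable.smul ε) hδi.locallyIntegrable (hv'.locallyIntegrable_grad.smul ε)
  refine integral_norm_le_of_forall_integral_inner_le hδi fun T hT hTc hT1 ↦ ?_
  have hTn : ContDiff ℝ 1 fun x ↦ -T x := hT.neg
  have e := integral_mul_divergence hδl.hasWeakGradient hδl.continuous.locallyIntegrable
    hδi.locallyIntegrable hTn hTc.neg
  simp only [inner_neg_right, integral_neg, neg_neg] at e
  rw [← e]
  refine integral_mul_divergence_le_of_decreasesPerimeter hδl.continuous.measurable
    (fun x ↦ infDist_nonneg) hR (fun t ht ↦ hdec.setOf_le_infDist hΩ hfin hne hpos ht) hw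
    (hδl.continuous.measurable.add (hv'm.const_mul ε))
    (hδl.continuous.locallyIntegrable.add (hv'.locallyIntegrable.smul ε))
    (hδi.add (hhi.smul ε)) (fun x ↦ le_add_of_nonneg_right (mul_nonneg hε (hv'0 x)))
    (fun t ht ↦ ?_) hTn hTc.neg (fun x ↦ by rw [norm_neg]; exact hT1 x)
  refine ne_top_of_le_ne_top hfin (measure_mono_ae ?_)
  filter_upwards [hv'.ae_eq_zero] with x hx hxt
  by_contra hxΩ
  have h1 : t ≤ δ x + ε * v' x := hxt
  have h2 : δ x = 0 := infDist_zero_of_mem hxΩ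
  rw [h2, hx hxΩ] at h1
  linarith

/-- The distance to the complement is weakly superharmonic in `Ω`. -/
theorem integral_inner_gradient_infDist_nonneg {R : ℝ} (hΩ : IsOpen Ω) (hfin : volume Ω ≠ ⊤)
    (hne : Ωᶜ.Nonempty) (hpos : ∀ x ∉ Ω, ∀ r > 0, 0 < volume (ball x r \ Ω))
    (hdec : DecreasesPerimeter Ω) (hR : ∀ x : E, infDist x Ωᶜ ≤ R) {v : E → ℝ} {h : E → E}
    (hv : MemSobolevLike Ω v h) (hv0 : ∀ᵐ x, 0 ≤ v x) :
    0 ≤ ∫ x, inner ℝ (gradient (fun y ↦ infDist y Ωᶜ) x) (h x) := by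
  set G : E → E := gradient fun y ↦ infDist y Ωᶜ
  have hG2 : MemLp G 2 := memLp_gradient_infDist hΩ hfin 2
  have hGi : Integrable G := memLp_one_iff_integrable.1 (memLp_gradient_infDist hΩ hfin 1)
  have hhi := hv.integrable_grad hΩ.measurableSet hfin
  have hin := hG2.integrable_inner_of_two hv.memLp_grad
  have hsq := (memLp_two_iff_integrable_sq_norm hv.memLp_grad.1).1 hv.memLp_grad
  set I := ∫ x, inner ℝ (G x) (h x)
  set H := ∫ x, ‖h x‖ ^ 2
  have key : ∀ ε > 0, 0 ≤ I + ε / 2 * H := by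
    intro ε hε
    have h1 : ∫ x, ‖G x‖ ≤ ∫ x, ‖G x + ε • h x‖ :=
      integral_norm_gradient_infDist_le hΩ hfin hne hpos hdec hR hv hv0 hε.le
    have hrem : Integrable fun x ↦ ε * inner ℝ (G x) (h x) + ε ^ 2 / 2 * ‖h x‖ ^ 2 :=
      (hin.const_mul ε).add (hsq.const_mul _)
    -- In `Ω`, where `‖G‖ = 1`, this is `s ≤ (1 + s²) / 2` with `s = ‖G + εh‖`. The linear term is
    -- the Dirichlet pairing precisely because `‖G‖ = 1`; outside `Ω` both gradients vanish.
    have h2 : ∫ x, ‖G x + ε • h x‖ ≤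
        ∫ x, (‖G x‖ + (ε * inner ℝ (G x) (h x) + ε ^ 2 / 2 * ‖h x‖ ^ 2)) := by
      refine integral_mono_ae (hGi.add (hhi.smul ε)).norm
        (hGi.norm.add hrem) ?_
      filter_upwards [hv.grad_ae_eq_zero, ae_norm_gradient_infDist_eq_one hΩ hne] with x hx0 hx1
      by_cases hxΩ : x ∈ Ω
      · have hGx : ‖G x‖ = 1 := hx1 hxΩ
        have hexp : ‖G x + ε • h x‖ ^ 2 =
            ‖G x‖ ^ 2 + 2 * (ε * inner ℝ (G x) (h x)) + ε ^ 2 * ‖h x‖ ^ 2 := by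
          rw [norm_add_sq_real, inner_smul_right, norm_smul, mul_pow, Real.norm_eq_abs, sq_abs]
        rw [hGx] at hexp ⊢
        nlinarith [sq_nonneg (‖G x + ε • h x‖ - 1)]
      · have hGx : G x = 0 := gradient_infDist_compl_eq_zero hxΩ
        simp [hGx, hx0 hxΩ]
    rw [integral_add hGi.norm hrem,
      integral_add (hin.const_mul ε) (hsq.const_mul _), integral_const_mul,
      integral_const_mul] at h2
    have h3 : 0 ≤ ε * (I + ε / 2 * H) := by
      have : ε * (I + ε / 2 * H) = ε * I + ε ^ 2 / 2 * H := by ring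
      rw [this]
      linarith
    exact nonneg_of_mul_nonneg_right h3 hε
  have hlim : Tendsto (fun ε : ℝ ↦ I + ε / 2 * H) (𝓝[>] 0) (𝓝 I) := by
    have : Tendsto (fun ε : ℝ ↦ I + ε / 2 * H) (𝓝 0) (𝓝 (I + 0 / 2 * H)) :=
      Continuous.tendsto (by fun_prop) 0
    rw [zero_div, zero_mul, add_zero] at this
    exact this.mono_left nhdsWithin_le_nhds
  exact ge_of_tendsto hlim (by filter_upwards [self_mem_nhdsWithin] with ε hε using key ε hε)

end Superharmonic

/-! ### The barrier and the bounds on the torsion function -/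

section Barrier

variable {d : ℕ} {Ω : Set (EuclideanSpace ℝ (Fin d))} {R : ℝ}

local notation "E" => EuclideanSpace ℝ (Fin d)

theorem LipschitzWith.ae_gradient_const_sub_const_mul {C : ℝ≥0} {f : E → ℝ}
    (hf : LipschitzWith C f) (a b : ℝ) :
    ∀ᵐ x, gradient (fun y ↦ a - b * f y) x = -(b • gradient f x) := by
  filter_upwards [hf.ae_differentiableAt (μ := volume)] with x hx
  have h1 : HasFDerivAt (fun y ↦ a - b * f y) (-(b • fderiv ℝ f x)) x :=
    (hx.hasFDerivAt.const_mul b).const_sub a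
  rw [gradient, h1.fderiv, map_neg, map_smul, gradient]

theorem lipschitzWith_const_sub_const_mul_infDist (a b : ℝ) :
    LipschitzWith ‖b‖₊ fun y : E ↦ a - b * infDist y Ωᶜ := by
  refine LipschitzWith.of_dist_le_mul fun x y ↦ ?_
  have h := (lipschitz_infDist_pt Ωᶜ).dist_le_mul x y
  rw [NNReal.coe_one, one_mul] at h
  rw [Real.dist_eq] at h ⊢
  rw [show a - b * infDist x Ωᶜ - (a - b * infDist y Ωᶜ) =
    -(b * (infDist x Ωᶜ - infDist y Ωᶜ)) by ring, abs_neg, abs_mul]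
  exact mul_le_mul_of_nonneg_left h (abs_nonneg b)

theorem abs_const_sub_infDist_le (hR : ∀ x : E, infDist x Ωᶜ ≤ R) {b : ℝ} (hb : 0 ≤ b)
    (hb1 : b ≤ 1) (x : E) : |R - b * infDist x Ωᶜ| ≤ R := by
  have h0 : 0 ≤ infDist x Ωᶜ := infDist_nonneg
  have h1 := hR x
  have h2 : b * infDist x Ωᶜ ≤ infDist x Ωᶜ := mul_le_of_le_one_left h0 hb1
  have h3 : 0 ≤ b * infDist x Ωᶜ := mul_nonneg hb h0
  rw [abs_le]
  constructor <;> linarith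

/-- The barrier `R δ - δ² / 2`, where `δ` is the distance to the complement. -/
theorem memSobolevLike_barrier (hΩ : IsOpen Ω) (hfin : volume Ω ≠ ⊤)
    (hR : ∀ x : E, infDist x Ωᶜ ≤ R) :
    MemSobolevLike Ω (fun x ↦ (R - 1 / 2 * infDist x Ωᶜ) * infDist x Ωᶜ)
      (fun x ↦ (R - infDist x Ωᶜ) • gradient (fun y ↦ infDist y Ωᶜ) x) where
  memLp := by
    have hc : Continuous fun x : E ↦ (R - 1 / 2 * infDist x Ωᶜ) * infDist x Ωᶜ := by
      have := continuous_infDist_pt (Ωᶜ)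
      fun_prop
    refine memLp_of_bound_of_eq_zero (C := R * R) hΩ.measurableSet hfin hc.aestronglyMeasurable
      (fun x ↦ ?_) (fun x hx ↦ ?_) 2
    · rw [norm_mul]
      refine mul_le_mul (abs_const_sub_infDist_le hR (by norm_num) (by norm_num) x) ?_
        (norm_nonneg _) (infDist_nonneg.trans (hR x))
      rw [Real.norm_of_nonneg infDist_nonneg]
      exact hR x
    · rw [infDist_zero_of_mem hx, mul_zero]
  memLp_grad := by
    refine memLp_of_bound_of_eq_zero (C := R * 1) hΩ.measurableSet hfin ?_
      (fun x ↦ ?_) (fun x hx ↦ ?_) 2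
    · exact (continuous_const.sub (continuous_infDist_pt _)).aestronglyMeasurable.smul
        (measurable_gradient _).aestronglyMeasurable
    · rw [norm_smul]
      refine mul_le_mul ?_ (norm_gradient_infDist_le x) (norm_nonneg _)
        (infDist_nonneg.trans (hR x))
      simpa using abs_const_sub_infDist_le hR zero_le_one le_rfl x
    · rw [gradient_infDist_compl_eq_zero hx, smul_zero]
  hasWeakGradient := by
    have hδ : LipschitzWith 1 fun y : E ↦ infDist y Ωᶜ := lipschitz_infDist_pt Ωᶜ
    have hR0 : 0 ≤ R := infDist_nonneg.trans (hR 0)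
    have h := hδ.hasWeakGradient.lipschitz_mul hδ.continuous.locallyIntegrable
      hδ.locallyIntegrable_gradient (M := ⟨R, hR0⟩)
      (lipschitzWith_const_sub_const_mul_infDist (Ω := Ω) R (1 / 2))
      (abs_const_sub_infDist_le hR (by norm_num) (by norm_num))
    refine h.congr (EventuallyEq.refl _ _) ?_
    filter_upwards [hδ.ae_gradient_const_sub_const_mul R (1 / 2)] with x hx
    rw [hx]
    module
  ae_eq_zero := Eventually.of_forall fun x hx ↦ by rw [infDist_zero_of_mem hx, mul_zero]

/-- The barrier is a supersolution of the torsion problem. -/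
theorem integral_le_integral_inner_barrier (hΩ : IsOpen Ω) (hfin : volume Ω ≠ ⊤)
    (hne : Ωᶜ.Nonempty) (hpos : ∀ x ∉ Ω, ∀ r > 0, 0 < volume (ball x r \ Ω))
    (hdec : DecreasesPerimeter Ω) (hR : ∀ x : E, infDist x Ωᶜ ≤ R) {v : E → ℝ} {h : E → E}
    (hv : MemSobolevLike Ω v h) (hv0 : ∀ᵐ x, 0 ≤ v x) :
    ∫ x, v x ≤
      ∫ x, inner ℝ ((R - infDist x Ωᶜ) • gradient (fun y ↦ infDist y Ωᶜ) x) (h x) := by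
  set G : E → E := gradient fun y ↦ infDist y Ωᶜ
  have hδ : LipschitzWith 1 fun y : E ↦ infDist y Ωᶜ := lipschitz_infDist_pt Ωᶜ
  have hR0 : 0 ≤ R := infDist_nonneg.trans (hR 0)
  have hab : ∀ x : E, |R - infDist x Ωᶜ| ≤ R := fun x ↦ by
    simpa using abs_const_sub_infDist_le hR zero_le_one le_rfl x
  have hca : Continuous fun x : E ↦ R - infDist x Ωᶜ :=
    continuous_const.sub (continuous_infDist_pt _)
  have hG1 : ∀ x, ‖G x‖ ≤ 1 := norm_gradient_infDist_le
  have hGm : AEStronglyMeasurable G volume := (measurable_gradient _).aestronglyMeasurable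
  -- Superharmonicity is tested with `(R - δ) v ≥ 0`: the pairing is `(R - δ) ∇δ · ∇v - v |∇δ|²`,
  -- and `|∇δ| = 1` in `Ω` leaves exactly `-v`.
  have hmem : MemSobolevLike Ω (fun x ↦ (R - infDist x Ωᶜ) * v x)
      (fun x ↦ (R - infDist x Ωᶜ) • h x - v x • G x) := by
    refine ⟨?_, ?_, ?_, ?_⟩
    · refine (hv.memLp.const_mul R).mono (hca.aestronglyMeasurable.mul hv.memLp.1)
        (Eventually.of_forall fun x ↦ ?_)
      rw [norm_mul, norm_mul, Real.norm_of_nonneg hR0]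
      exact mul_le_mul_of_nonneg_right (hab x) (norm_nonneg _)
    · refine MemLp.sub ?_ ?_
      · refine (hv.memLp_grad.const_smul R).mono (hca.aestronglyMeasurable.smul hv.memLp_grad.1)
          (Eventually.of_forall fun x ↦ ?_)
        rw [norm_smul, Pi.smul_apply, norm_smul, Real.norm_of_nonneg hR0]
        exact mul_le_mul_of_nonneg_right (hab x) (norm_nonneg _)
      · refine hv.memLp.mono (hv.memLp.1.smul hGm) (Eventually.of_forall fun x ↦ ?_)
        rw [norm_smul]
        exact mul_le_of_le_one_right (norm_nonneg _) (hG1 x)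
    · have hw := hv.hasWeakGradient.lipschitz_mul hv.locallyIntegrable hv.locallyIntegrable_grad
        (M := ⟨R, hR0⟩) (lipschitzWith_const_sub_const_mul_infDist (Ω := Ω) R 1)
        (abs_const_sub_infDist_le hR zero_le_one le_rfl)
      refine hw.congr (Eventually.of_forall fun x ↦ by simp only [one_mul]) ?_
      filter_upwards [hδ.ae_gradient_const_sub_const_mul R 1] with x hx
      rw [hx, one_mul, one_smul, smul_neg, ← sub_eq_add_neg]
    · filter_upwards [hv.ae_eq_zero] with x h1 hx
      rw [h1 hx, mul_zero]
  have hsup := integral_inner_gradient_infDist_nonneg hΩ hfin hne hpos hdec hR hmem (by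
    filter_upwards [hv0] with x hx using mul_nonneg (sub_nonneg.2 (hR x)) hx)
  have hb := (memSobolevLike_barrier hΩ hfin hR).memLp_grad.integrable_inner_of_two hv.memLp_grad
  have hvi := hv.integrable hΩ.measurableSet hfin
  have e : ∫ x, inner ℝ (G x) ((R - infDist x Ωᶜ) • h x - v x • G x) =
      ∫ x, (inner ℝ ((R - infDist x Ωᶜ) • G x) (h x) - v x) := by
    refine integral_congr_ae ?_
    filter_upwards [hv.ae_eq_zero, ae_norm_gradient_infDist_eq_one hΩ hne] with x hx0 hx1
    rw [inner_sub_right, inner_smul_right, inner_smul_right, inner_smul_left,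
      real_inner_self_eq_norm_sq]
    by_cases hx : x ∈ Ω
    · have : ‖G x‖ = 1 := hx1 hx
      simp [this]
    · simp [hx0 hx]
  rw [e, integral_sub hb hvi] at hsup
  linarith

theorem inner_indicator_self {u : E → ℝ} {g : E → E} (x : E) :
    inner ℝ (g x) (indicator {x | 0 < u x} g x) = ‖indicator {x | 0 < u x} g x‖ ^ 2 := by
  by_cases hx : 0 < u x
  · rw [indicator_of_mem (by exact hx), real_inner_self_eq_norm_sq]
  · rw [indicator_of_notMem (by exact hx)]; simp

/-- Testing with the negative part gives `-∫ |∇w⁻|² = ∫ w⁻ ≥ 0`, so `w⁻` has zero gradient. -/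
theorem torsion_nonneg {w : E → ℝ} {g : E → E} (hw : MemSobolevLike Ω w g)
    (htest : ∀ (v : E → ℝ) (h : E → E), MemSobolevLike Ω v h →
      ∫ x, inner ℝ (g x) (h x) = ∫ x, v x) (hΩc : volume Ωᶜ ≠ 0) : ∀ᵐ x, 0 ≤ w x := by
  have hv := hw.neg.max_zero
  have h1 := htest _ _ hv
  have h2 : 0 ≤ ∫ x, max (-w x) 0 := integral_nonneg fun x ↦ le_max_right _ _
  have e : ∀ x, inner ℝ (g x) (indicator {x | 0 < -w x} (fun x ↦ -g x) x) =
      -‖indicator {x | 0 < -w x} (fun x ↦ -g x) x‖ ^ 2 := fun x ↦ by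
    rw [← inner_indicator_self, inner_neg_left, neg_neg]
  simp_rw [e] at h1
  rw [integral_neg] at h1
  filter_upwards [hv.ae_eq_zero_of_integral_norm_sq_nonpos hΩc (by linarith)] with x hx
  linarith [max_eq_right_iff.1 hx]

/-- Comparison with a supersolution: testing with the positive part of `w` minus the barrier shows
that this part has zero energy. The term `-δ²/2` of the barrier is then dropped. -/
theorem torsion_le_barrier (hΩ : IsOpen Ω) (hfin : volume Ω ≠ ⊤)
    (hne : Ωᶜ.Nonempty) (hpos : ∀ x ∉ Ω, ∀ r > 0, 0 < volume (ball x r \ Ω))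
    (hdec : DecreasesPerimeter Ω) (hR : ∀ x : E, infDist x Ωᶜ ≤ R)
    {w : E → ℝ} {g : E → E} (hw : MemSobolevLike Ω w g)
    (htest : ∀ (v : E → ℝ) (h : E → E), MemSobolevLike Ω v h →
      ∫ x, inner ℝ (g x) (h x) = ∫ x, v x) (hΩc : volume Ωᶜ ≠ 0) :
    ∀ᵐ x, w x ≤ R * infDist x Ωᶜ := by
  have hb := memSobolevLike_barrier hΩ hfin hR
  have hu := hw.sub hb
  have hv := hu.max_zero
  have h1 := htest _ _ hv
  have h2 := integral_le_integral_inner_barrier hΩ hfin hne hpos hdec hR hv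
    (Eventually.of_forall fun x ↦ le_max_right _ _)
  have i1 := hw.memLp_grad.integrable_inner_of_two hv.memLp_grad
  have i2 := hb.memLp_grad.integrable_inner_of_two hv.memLp_grad
  have h3 : ∫ x, ‖indicator {x | 0 < w x - (R - 1 / 2 * infDist x Ωᶜ) * infDist x Ωᶜ}
      (fun x ↦ g x - (R - infDist x Ωᶜ) • gradient (fun y ↦ infDist y Ωᶜ) x) x‖ ^ 2 ≤ 0 := by
    simp_rw [← inner_indicator_self, inner_sub_left]
    rw [integral_sub i1 i2]
    linarith
  filter_upwards [hv.ae_eq_zero_of_integral_norm_sq_nonpos hΩc h3] with x hx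
  have h4 := max_eq_right_iff.1 hx
  nlinarith [sq_nonneg (infDist x Ωᶜ)]

end Barrier

/-! ### Translation comparison and the Lipschitz representative -/

section Lipschitz

variable {d : ℕ} {Ω : Set (EuclideanSpace ℝ (Fin d))} {R : ℝ}

local notation "E" => EuclideanSpace ℝ (Fin d)

theorem ae_comp_add {p : E → Prop} (h : ∀ᵐ x, p x) (a : E) : ∀ᵐ x, p (x + a) :=
  (measurePreserving_add_right (volume : Measure E) a).quasiMeasurePreserving.ae h

theorem MeasureTheory.MemLp.comp_add {F : Type*} [NormedAddCommGroup F] {f : E → F} {p : ℝ≥0∞}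
    (hf : MemLp f p) (a : E) : MemLp (fun x ↦ f (x + a)) p :=
  hf.comp_measurePreserving (measurePreserving_add_right volume a)

/-- Comparison of the torsion function with its translates. -/
theorem torsion_translate_sub_le {w : E → ℝ} {g : E → E} (hw : MemSobolevLike Ω w g)
    (htest : ∀ (v : E → ℝ) (h : E → E), MemSobolevLike Ω v h →
      ∫ x, inner ℝ (g x) (h x) = ∫ x, v x) (hΩc : volume Ωᶜ ≠ 0) (hR0 : 0 ≤ R)
    (hw0 : ∀ᵐ x, 0 ≤ w x) (hwR : ∀ᵐ x, w x ≤ R * infDist x Ωᶜ) (a : E) :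
    ∀ᵐ x, w (x + a) - w x ≤ R * ‖a‖ := by
  set k := R * ‖a‖
  have hk : 0 ≤ k := mul_nonneg hR0 (norm_nonneg a)
  have hwa : MemLp (fun x ↦ w (x + a)) 2 := hw.memLp.comp_add a
  have hga : MemLp (fun x ↦ g (x + a)) 2 := hw.memLp_grad.comp_add a
  have hu : MemLp (fun x ↦ w (x + a) - w x) 2 := hwa.sub hw.memLp
  have hgu : MemLp (fun x ↦ g (x + a) - g x) 2 := hga.sub hw.memLp_grad
  have hul := hu.locallyIntegrable one_le_two
  have hgl := hgu.locallyIntegrable one_le_two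
  have hukl : LocallyIntegrable fun x ↦ w (x + a) - w x + -k := hul.add (locallyIntegrable_const _)
  have hweak := ((((hw.hasWeakGradient.comp_add a).sub hw.hasWeakGradient
    (hwa.locallyIntegrable one_le_two) hw.locallyIntegrable (hga.locallyIntegrable one_le_two)
    hw.locallyIntegrable_grad).add_const hul hgl (-k)).max_zero hukl hgl)
  set v : E → ℝ := fun x ↦ max (w (x + a) - w x + -k) 0
  set H : E → E := indicator {x | 0 < w (x + a) - w x + -k} fun x ↦ g (x + a) - g x
  -- Here the barrier enters: for `x ∉ Ω` the point `x + a` is within `‖a‖` of `Ωᶜ`, so `w (x + a) ≤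
  -- R ‖a‖ = k`, while `w x ≥ 0`.
  have hv : MemSobolevLike Ω v H := by
    refine ⟨?_, ?_, hweak, ?_⟩
    · refine hu.mono hukl.max_zero.aestronglyMeasurable (Eventually.of_forall fun x ↦ ?_)
      rw [Real.norm_of_nonneg (le_max_right _ _)]
      exact max_le (by linarith [le_abs_self (w (x + a) - w x), Real.norm_eq_abs (w (x + a) - w x)])
        (norm_nonneg _)
    · exact hgu.mono (hukl.indicator_pos hgl).aestronglyMeasurable
        (Eventually.of_forall fun x ↦ norm_indicator_le_norm_self _ _)
    · filter_upwards [hw0, ae_comp_add hwR a] with x h1 h2 hx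
      refine max_eq_right ?_
      have h3 : infDist (x + a) Ωᶜ ≤ ‖a‖ := by
        refine (infDist_le_dist_of_mem (show x ∈ Ωᶜ from hx)).trans ?_
        rw [dist_self_add_left]
      have h4 := mul_le_mul_of_nonneg_left h3 hR0
      linarith
  -- Shifting the test function back by `a` tests the equation of the translate `w (· + a)` with
  -- `v`. Admissibility uses `w = 0` off `Ω` and `w ≥ 0`.
  have hva : MemSobolevLike Ω (fun x ↦ v (x + -a)) (fun x ↦ H (x + -a)) := by
    refine ⟨hv.memLp.comp_add _, hv.memLp_grad.comp_add _, hv.hasWeakGradient.comp_add _, ?_⟩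
    filter_upwards [hw.ae_eq_zero, ae_comp_add hw0 (-a)] with x h1 h2 hx
    refine max_eq_right ?_
    rw [neg_add_cancel_right, h1 hx]
    linarith
  have t1 := htest _ _ hv
  have t2 := htest _ _ hva
  rw [integral_add_right_eq_self v, ← integral_add_right_eq_self _ a] at t2
  simp only [add_neg_cancel_right] at t2
  have i1 := hw.memLp_grad.integrable_inner_of_two hv.memLp_grad
  have i2 := hga.integrable_inner_of_two hv.memLp_grad
  -- Both equations have the same right-hand side `∫ v`, so the energy of `v` is their difference,
  -- zero.
  have h3 : ∫ x, ‖H x‖ ^ 2 ≤ 0 := by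
    have e : ∀ x, ‖H x‖ ^ 2 = inner ℝ (g (x + a)) (H x) - inner ℝ (g x) (H x) := fun x ↦ by
      rw [← inner_sub_left]
      exact (inner_indicator_self (u := fun x ↦ w (x + a) - w x + -k)
        (g := fun x ↦ g (x + a) - g x) x).symm
    simp_rw [e]
    rw [integral_sub i2 i1, t1, t2, sub_self]
  filter_upwards [hv.ae_eq_zero_of_integral_norm_sq_nonpos hΩc h3] with x hx
  linarith [max_eq_right_iff.1 hx]

/-- A function whose translates differ from it by at most a multiple of the length of the
translation has a Lipschitz representative. -/
theorem exists_lipschitzWith_ae_eq {w : E → ℝ} (hw : LocallyIntegrable w) (C : ℝ≥0)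
    (h : ∀ a : E, ∀ᵐ x, w (x + a) - w x ≤ C * ‖a‖) :
    ∃ W : E → ℝ, LipschitzWith C W ∧ ∀ᵐ x, W x = w x := by
  -- Averaging makes the almost everywhere inequality hold everywhere with the same `C`. It passes
  -- to the points of convergence of the mollifications, and the limit is extended from that set of
  -- full measure.
  have hmol : ∀ n x y, mollify n w x - mollify n w y ≤ C * dist x y := fun n x y ↦ by
    rw [mollify_apply, mollify_apply, ← integral_sub (integrable_mollify_integrand_left n hw x)
      (integrable_mollify_integrand_left n hw y)]
    calc ∫ t, (mollifier d n t • w (x - t) - mollifier d n t • w (y - t))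
        ≤ ∫ t, mollifier d n t * (C * dist x y) := by
          refine integral_mono_ae ((integrable_mollify_integrand_left n hw x).sub
            (integrable_mollify_integrand_left n hw y)) ((integrable_mollifier n).mul_const _) ?_
          have hq : ∀ᵐ t : E, w (y - t + (x - y)) - w (y - t) ≤ C * ‖x - y‖ :=
            (Measure.measurePreserving_sub_left (volume : Measure E) y).quasiMeasurePreserving.ae
              (h (x - y))
          filter_upwards [hq] with t ht
          rw [sub_add_sub_comm, add_comm t, add_sub_add_left_eq_sub] at ht
          rw [← smul_sub, smul_eq_mul, dist_eq_norm]
          exact mul_le_mul_of_nonneg_left ht (mollifier_nonneg n t)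
      _ = C * dist x y := by rw [integral_mul_const, integral_mollifier, one_mul]
  have hlim := ae_tendsto_mollify hw
  have hlip : LipschitzOnWith C w {x | Tendsto (fun n ↦ mollify n w x) atTop (𝓝 (w x))} := by
    refine LipschitzOnWith.of_le_add_mul C fun x hx y hy ↦ ?_
    have := le_of_tendsto' (hx.sub hy) fun n ↦ hmol n x y
    linarith
  obtain ⟨W, hW, hWw⟩ := hlip.extend_real
  refine ⟨W, hW, ?_⟩
  filter_upwards [hlim] with x hx
  exact (hWw hx).symm

theorem exists_lipschitz_torsion (hΩ : IsOpen Ω) (hfin : volume Ω ≠ ⊤)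
    (huniv : volume (univ : Set E) = ⊤)
    (hpos : ∀ x ∉ Ω, ∀ r > 0, 0 < volume (ball x r \ Ω)) (hdec : DecreasesPerimeter Ω)
    {w : E → ℝ} (hw : IsTorsionFunction Ω w) :
    ∃ (K : ℝ≥0) (W : E → ℝ), LipschitzWith K W ∧ (∀ᵐ x, W x = w x) ∧ ∀ x ∉ Ω, W x = 0 := by
  have hΩc : volume Ωᶜ ≠ 0 := by
    intro h0
    have := measure_union_le (μ := volume) Ω Ωᶜ
    rw [union_compl_self, huniv, h0, add_zero, top_le_iff] at this
    exact hfin this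
  have hne : Ωᶜ.Nonempty := nonempty_of_measure_ne_zero hΩc
  obtain ⟨R, hR0, hR⟩ := exists_forall_infDist_le hfin huniv
  obtain ⟨g, hwg, htest⟩ := hw
  have h0 := torsion_nonneg hwg htest hΩc
  have h1 := torsion_le_barrier hΩ hfin hne hpos hdec hR hwg htest hΩc
  obtain ⟨W, hW, hWw⟩ := exists_lipschitzWith_ae_eq hwg.locallyIntegrable ⟨R, hR0.le⟩
    (torsion_translate_sub_le hwg htest hΩc hR0.le h0 h1)
  refine ⟨_, W, hW, hWw, fun x hx ↦ ?_⟩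
  -- The bounds `0 ≤ W ≤ Rδ` hold almost everywhere; continuity of both sides makes them hold at
  -- every point, in particular on `Ωᶜ`.
  have hclamp : (fun x ↦ max 0 (min (W x) (R * infDist x Ωᶜ))) = W := by
    refine (Continuous.ae_eq_iff_eq volume ?_ hW.continuous).1 ?_
    · exact continuous_const.max (hW.continuous.min
        (continuous_const.mul (continuous_infDist_pt _)))
    · filter_upwards [h0, h1, hWw] with y hy0 hy1 hy
      rw [hy, min_eq_left hy1, max_eq_right hy0]
  have hx0 : infDist x Ωᶜ = 0 := infDist_zero_of_mem hx
  rw [← hclamp]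
  simp [hx0]

end Lipschitz

/-! ### Reduction to the essential interior -/

section EssentialInterior

variable {d : ℕ} {Ω : Set (EuclideanSpace ℝ (Fin d))}

local notation "E" => EuclideanSpace ℝ (Fin d)

/-- The points having a neighbourhood contained in `Ω` up to a null set. -/
def essInterior (Ω : Set E) : Set E :=
  {x | ∃ r > 0, volume (ball x r \ Ω) = 0}

theorem isOpen_essInterior : IsOpen (essInterior Ω) := by
  refine isOpen_iff.2 fun x ⟨r, hr, h⟩ ↦ ⟨r, hr, fun y hy ↦ ?_⟩
  refine ⟨r - dist y x, sub_pos.2 hy, measure_mono_null (sdiff_subset_sdiff_left ?_) h⟩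
  exact ball_subset_ball' (by linarith)

theorem subset_essInterior (hΩ : IsOpen Ω) : Ω ⊆ essInterior Ω := fun x hx ↦ by
  obtain ⟨r, hr, h⟩ := isOpen_iff.1 hΩ x hx
  exact ⟨r, hr, by rw [sdiff_eq_empty.2 h, measure_empty]⟩

theorem volume_essInterior_diff : volume (essInterior Ω \ Ω) = 0 := by
  refine measure_null_of_locally_null _ fun x hx ↦ ?_
  obtain ⟨r, hr, h⟩ := hx.1
  refine ⟨ball x r \ Ω, ?_, h⟩
  filter_upwards [self_mem_nhdsWithin, mem_nhdsWithin_of_mem_nhds (ball_mem_nhds x hr)]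
    with y hy hyb using ⟨hyb, hy.2⟩

theorem essInterior_ae_eq (hΩ : IsOpen Ω) : essInterior Ω =ᵐ[volume] Ω :=
  (ae_le_set.2 volume_essInterior_diff).antisymm (subset_essInterior hΩ).eventuallyLE

/-- Enlarging `Ω` by a null set creates no new essentially interior points; this supplies the
hypothesis `hpos` of the earlier results. -/
theorem volume_ball_diff_essInterior_pos {x : E} (hx : x ∉ essInterior Ω) {r : ℝ} (hr : 0 < r) :
    0 < volume (ball x r \ essInterior Ω) := by
  refine pos_iff_ne_zero.2 fun h0 ↦ hx ⟨r, hr, ?_⟩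
  refine measure_mono_null (t := (ball x r \ essInterior Ω) ∪ (essInterior Ω \ Ω)) ?_
    (measure_union_null h0 volume_essInterior_diff)
  intro y hy
  by_cases h : y ∈ essInterior Ω
  · exact Or.inr ⟨h, hy.2⟩
  · exact Or.inl ⟨hy.1, h⟩

/-- Volume and perimeter ignore null sets, and supersets of the essential interior are supersets of
the open set `Ω`. -/
theorem IsPerimeterSupersolution.essInterior (h : IsPerimeterSupersolution Ω) (hΩ : IsOpen Ω) :
    IsPerimeterSupersolution (essInterior Ω) where
  nullMeasurableSet := isOpen_essInterior.measurableSet.nullMeasurableSet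
  volume_lt_top := by
    rw [measure_congr (essInterior_ae_eq hΩ)]
    exact h.volume_lt_top
  perimeter_lt_top := by
    rw [perimeter_congr (essInterior_ae_eq hΩ)]
    exact h.perimeter_lt_top
  perimeter_le := fun Ω' hm hsub hfin ↦ by
    rw [perimeter_congr (essInterior_ae_eq hΩ)]
    exact h.perimeter_le Ω' hm ((subset_essInterior hΩ).trans hsub) hfin

theorem MemSobolevLike.congr_set {Ω' : Set E} {u : E → ℝ} {g : E → E}
    (hu : MemSobolevLike Ω u g) (h : Ω =ᵐ[volume] Ω') : MemSobolevLike Ω' u g where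
  memLp := hu.memLp
  memLp_grad := hu.memLp_grad
  hasWeakGradient := hu.hasWeakGradient
  ae_eq_zero := by
    filter_upwards [hu.ae_eq_zero, h.mem_iff] with x h1 h2 hx using h1 fun h3 ↦ hx (h2.1 h3)

theorem IsTorsionFunction.congr_set {Ω' : Set E} {w : E → ℝ} (hw : IsTorsionFunction Ω w)
    (h : Ω =ᵐ[volume] Ω') : IsTorsionFunction Ω' w := by
  obtain ⟨g, hg, htest⟩ := hw
  exact ⟨g, hg.congr_set h, fun v k hv ↦ htest v k (hv.congr_set h.symm)⟩

theorem volume_univ_eq_top (hd : d ≠ 0) : volume (univ : Set E) = ⊤ := by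
  have : Nonempty (Fin d) := ⟨⟨0, Nat.pos_of_ne_zero hd⟩⟩
  have : Nontrivial E := inferInstance
  have : NoncompactSpace E := NormedSpace.noncompactSpace ℝ E
  exact measure_univ_of_isAddLeftInvariant volume

end EssentialInterior

theorem proposition5 {d : ℕ} (Ω : Set (EuclideanSpace ℝ (Fin d))) (hΩ : IsOpen Ω)
    (hsup : IsPerimeterSupersolution Ω)
    (w : EuclideanSpace ℝ (Fin d) → ℝ) (hw : IsTorsionFunction Ω w) :
    ∃ (K : ℝ≥0) (W : EuclideanSpace ℝ (Fin d) → ℝ),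
      LipschitzWith K W ∧
      (∀ᵐ x ∂volume, W x = w x) ∧
      (∀ x, (∀ r > 0, 0 < volume (Metric.ball x r \ Ω)) → W x = 0) := by
  -- In dimension 0 the space is a single point of finite measure, so the bound on `δ` is
  -- unavailable; there every function is Lipschitz and `w` itself serves.
  rcases eq_or_ne d 0 with rfl | hd
  · refine ⟨0, w, fun x y ↦ by simp [Subsingleton.elim x y],
      Eventually.of_forall fun _ ↦ rfl, fun x hx ↦ ?_⟩
    obtain ⟨g, hg, -⟩ := hw
    by_contra hne
    refine (hx 1 one_pos).ne' (measure_mono_null ?_ hg.ae_eq_zero)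
    intro y hy hy0
    rw [Subsingleton.elim x y] at hne
    exact hne (hy0 hy.2)
  · have hsup' := hsup.essInterior hΩ
    obtain ⟨K, W, hW, hWw, hW0⟩ := exists_lipschitz_torsion isOpen_essInterior
      hsup'.volume_lt_top.ne (volume_univ_eq_top hd)
      (fun x hx r hr ↦ volume_ball_diff_essInterior_pos hx hr)
      (hsup'.decreasesPerimeter isOpen_essInterior.measurableSet)
      (hw.congr_set (essInterior_ae_eq hΩ).symm)
    exact ⟨K, W, hW, hWw, fun x hx ↦ hW0 x fun ⟨r, hr, h0⟩ ↦ (hx r hr).ne' h0⟩
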